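/- Let $S$ be a finite nonempty set of states and $A$ a finite set of moves. A game structure $G=\langle S,A,\Gamma_1,\Gamma_2,\delta\rangle$ assigns to each state $s$ nonempty sets $\Gamma_1(s),\Gamma_2(s)\subseteq A$ of moves available to players 1 and 2, and to all $s\in S$, $a\in\Gamma_1(s)$, $b\in\Gamma_2(s)$ a probability distribution $\delta(s,a,b)$ on $S$; it is a player-1 MDP if $|\Gamma_2(s)|=1$ for all $s$. A strategy of player $i$ maps every nonempty finite sequence of states ending in a state $s$ to a probability distribution on $\Gamma_i(s)$; it is pure if these distributions are Dirac, and memoryless if they depend only on the last state. For a priority function $p:S\to\mathbb N$, the parity objective $\Phi$ is the ($\{0,1\}$-valued) indicator of the set of sequences $s_0s_1s_2\dots$ for which the minimum of $p$ over the states visited infinitely often is even. Put $\mathsf{Val}^{\pi_1}(G,\Phi)(s)=\inf_{\pi_2}\mathbb E_s^{\pi_1,\pi_2}(\Phi)$ and $\mathsf{Val}(G,\Phi)(s)=\sup_{\pi_1}\mathsf{Val}^{\pi_1}(G,\Phi)(s)$. A player-1 strategy $\pi_1$ is optimal if $\mathsf{Val}^{\pi_1}(G,\Phi)(s)=\mathsf{Val}(G,\Phi)(s)$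 for all $s$, and $\varepsilon$-optimal if $\mathsf{Val}^{\pi_1}(G,\Phi)(s)\ge\mathsf{Val}(G,\Phi)(s)-\varepsilon$ for all $s$. Two game structures $G_1,G_2$ with the same $S,A,\Gamma_1,\Gamma_2$ and transition functions $\delta_1,\delta_2$ are structurally equivalent, $G_1\equiv G_2$, if $\delta_1(s,a,b)$ and $\delta_2(s,a,b)$ have the same support for all $s\in S$, $a\in\Gamma_1(s)$, $b\in\Gamma_2(s)$. Let $\mathit{dist}_A(G_1,G_2)$ be the maximum of $|\delta_1(s,a,b)(t)-\delta_2(s,a,b)(t)|$ over $s,t\in S$ and available $a,b$; and, for $G_1\equiv G_2$, let $\mathit{dist}_R(G_1,G_2)$ be the maximum of the ratios $\frac{\delta_1(s,a,b)(t)}{\delta_2(s,a,b)(t)}$ and $\frac{\delta_2(s,a,b)(t)}{\delta_1(s,a,b)(t)}$ over $s\in S$, available $a,b$, and $t$ in the common support, minus $1$. **Theorem.** Let $G_1$ be a player-1 MDP whose minimum positive transition probability is $\eta>0$. 1. For every player-1 MDP $G_2\equiv G_1$, every parity objective $\Phi$ and every $s\in S$, $$|\mathsf{Val}(G_1,\Phi)(s)-\mathsf{Val}(G_2,\Phi)(s)|\le(1+\mathit{dist}_R(G_1,G_2))^{2|S|}-1$$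 and $$|\mathsf{Val}(G_1,\Phi)(s)-\mathsf{Val}(G_2,\Phi)(s)|\le\Big(1+\frac{\mathit{dist}_A(G_1,G_2)}{\eta}\Big)^{2|S|}-1 .$$ Moreover, if $\eta'$ is the minimum of all positive transition probabilities of $G_1$ and of $G_2$, then $$(1+\mathit{dist}_R(G_1,G_2))^{2|S|}-1\le\Big(1+\frac{\mathit{dist}_A(G_1,G_2)}{\eta'}\Big)^{2|S|}-1 .$$ 2. Let $\varepsilon>0$ and $\beta\le\frac{\eta}{2}\big((1+\frac{\varepsilon}{2})^{1/(2|S|)}-1\big)$. For every $G_2\equiv G_1$ with $\mathit{dist}_A(G_1,G_2)\le\beta$ and every parity objective $\Phi$, every pure memoryless optimal strategy of player 1 in $G_1$ is $\varepsilon$-optimal in $G_2$. -/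

import Mathlib

open MeasureTheory ProbabilityTheory Filter

/-- A two-player concurrent stochastic game structure with state space `S` and set of moves `A`.
Only the transition probabilities at available moves are ever used. -/
structure ConcurrentGame (S A : Type*) where
  /-- the moves available to player 1 at a state -/
  moves₁ : S → Finset A
  /-- the moves available to player 2 at a state -/
  moves₂ : S → Finset A
  moves₁_nonempty : ∀ s, (moves₁ s).Nonempty
  moves₂_nonempty : ∀ s, (moves₂ s).Nonempty
  /-- the probabilistic transition function -/
  δ : S → A → A → PMF S

/-- A nonempty finite sequence of states `s₀, …, sₙ`. -/
abbrev History (S : Type*) (n : ℕ) : Type _ := Finset.Iic n → S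

/-- The current (last) state `sₙ` of a history `s₀, …, sₙ`. -/
def History.last {S : Type*} {n : ℕ} (h : History S n) : S :=
  h ⟨n, Finset.mem_Iic.2 le_rfl⟩

/-- A (history-dependent, randomized) strategy maps every nonempty finite sequence of states
to a probability distribution on moves. Availability of moves is imposed in
`ConcurrentGame.strategies₁` and `ConcurrentGame.strategies₂`. -/
abbrev Strategy (S A : Type*) : Type _ := (n : ℕ) → History S n → PMF A

namespace Strategy

variable {S A : Type*}

/-- A strategy is pure if it always selects some move with probability one. -/
def IsPure (π : Strategy S A) : Prop :=
  ∀ (n : ℕ) (h : History S n), ∃ a : A, π n h a = 1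

/-- A strategy is memoryless if its choice depends on the current state only:
`π (x · s) = π (s)`. -/
def IsMemoryless (π : Strategy S A) : Prop :=
  ∀ (n : ℕ) (h : History S n), π n h = π 0 (fun _ => h.last)

end Strategy

/-- The set of states that a sequence of states visits infinitely often. -/
def infStates {S : Type*} (ω : ℕ → S) : Set S :=
  {s | ∃ᶠ k in atTop, ω k = s}

/-- The (even) parity objective of a priority function `p`: the minimum priority visited
infinitely often is even. -/
def parity {S : Type*} (p : S → ℕ) : Set (ℕ → S) :=
  {ω | Even (sInf (p '' infStates ω))}

namespace ConcurrentGame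

variable {S A : Type*}

/-- In a player-1 Markov decision process, player 2 has exactly one move at every state. -/
def IsPlayer1MDP (G : ConcurrentGame S A) : Prop :=
  ∀ s, (G.moves₂ s).card = 1

/-- The strategies of player 1: only available moves are prescribed. -/
def strategies₁ (G : ConcurrentGame S A) : Set (Strategy S A) :=
  {π | ∀ (n : ℕ) (h : History S n), (π n h).support ⊆ (G.moves₁ h.last : Set A)}

/-- The strategies of player 2: only available moves are prescribed. -/
def strategies₂ (G : ConcurrentGame S A) : Set (Strategy S A) :=
  {π | ∀ (n : ℕ) (h : History S n), (π n h).support ⊆ (G.moves₂ h.last : Set A)}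

/-- The distribution of the next state after the history `h`: the two players draw their moves
independently from their strategies, and the successor is drawn from `δ`. -/
noncomputable def next (G : ConcurrentGame S A) (π₁ π₂ : Strategy S A) {n : ℕ}
    (h : History S n) : PMF S :=
  (π₁ n h).bind fun a => (π₂ n h).bind fun b => G.δ h.last a b

section Law

variable [Fintype S] [MeasurableSpace S] [DiscreteMeasurableSpace S]

/-- `ConcurrentGame.next` as a Markov kernel from histories to states. -/
noncomputable def stepKernel (G : ConcurrentGame S A) (π₁ π₂ : Strategy S A) (n : ℕ) :
    Kernel (History S n) S :=
  Kernel.ofFunOfCountable fun h => (G.next π₁ π₂ h).toMeasure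

instance (G : ConcurrentGame S A) (π₁ π₂ : Strategy S A) (n : ℕ) :
    IsMarkovKernel (G.stepKernel π₁ π₂ n) :=
  ⟨fun h => PMF.toMeasure.isProbabilityMeasure (G.next π₁ π₂ h)⟩

/-- The probability measure on infinite sequences of states when the game starts in `s` and
the players use the strategies `π₁` and `π₂` (given by the Ionescu-Tulcea theorem). -/
noncomputable def law (G : ConcurrentGame S A) (π₁ π₂ : Strategy S A) (s : S) :
    Measure (ℕ → S) :=
  Kernel.traj (X := fun _ => S) (G.stepKernel π₁ π₂) 0 (fun _ => s)

/-- The value `inf_{π₂} 𝔼_s^{π₁,π₂}(Φ)` that a strategy `π₁` of player 1 guarantees. -/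
noncomputable def valOf (G : ConcurrentGame S A) (Φ : (ℕ → S) → ℝ) (π₁ : Strategy S A)
    (s : S) : ℝ :=
  ⨅ π₂ : G.strategies₂, ∫ ω, Φ ω ∂(G.law π₁ π₂ s)

/-- The value `sup_{π₁} inf_{π₂} 𝔼_s^{π₁,π₂}(Φ)` of player 1. -/
noncomputable def val (G : ConcurrentGame S A) (Φ : (ℕ → S) → ℝ) (s : S) : ℝ :=
  ⨆ π₁ : G.strategies₁, G.valOf Φ π₁ s

/-- `π₁` is an optimal strategy of player 1. -/
def IsOptimal (G : ConcurrentGame S A) (Φ : (ℕ → S) → ℝ) (π₁ : Strategy S A) : Prop :=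
  π₁ ∈ G.strategies₁ ∧ ∀ s, G.valOf Φ π₁ s = G.val Φ s

/-- `π₁` is an `ε`-optimal strategy of player 1. -/
def IsEpsOptimal (G : ConcurrentGame S A) (Φ : (ℕ → S) → ℝ) (ε : ℝ) (π₁ : Strategy S A) :
    Prop :=
  π₁ ∈ G.strategies₁ ∧ ∀ s, G.valOf Φ π₁ s ≥ G.val Φ s - ε

end Law

/-- The parity objective as a `{0, 1}`-valued function on sequences of states. -/
noncomputable def parityObj (p : S → ℕ) : (ℕ → S) → ℝ :=
  (parity p).indicator 1

/-- Two game structures on the same states and moves, with the same move assignments, are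
structurally equivalent if their transition functions have the same supports. -/
def StructEquiv (G₁ G₂ : ConcurrentGame S A) : Prop :=
  G₁.moves₁ = G₂.moves₁ ∧ G₁.moves₂ = G₂.moves₂ ∧
    ∀ s, ∀ a ∈ G₁.moves₁ s, ∀ b ∈ G₁.moves₂ s, (G₁.δ s a b).support = (G₂.δ s a b).support

/-- The transition probability `δ(s, a, b)(t)` as a real number. -/
noncomputable def prob (G : ConcurrentGame S A) (s : S) (a b : A) (t : S) : ℝ :=
  (G.δ s a b t).toReal

/-- The set of positive transition probabilities (at available moves). -/
def posProbs (G : ConcurrentGame S A) : Set ℝ :=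
  {x | ∃ s, ∃ a ∈ G.moves₁ s, ∃ b ∈ G.moves₂ s, ∃ t, x = G.prob s a b t ∧ 0 < x}

/-- The absolute distance: the maximum difference of transition probabilities
(the supremum of a finite set). -/
noncomputable def distA (G₁ G₂ : ConcurrentGame S A) : ℝ :=
  sSup {x | ∃ s, ∃ a ∈ G₁.moves₁ s, ∃ b ∈ G₁.moves₂ s, ∃ t,
    x = |G₁.prob s a b t - G₂.prob s a b t|}

/-- The ratio distance of structurally equivalent game structures: the maximum ratio of
corresponding positive transition probabilities (the supremum of a finite set), minus one. -/
noncomputable def distR (G₁ G₂ : ConcurrentGame S A) : ℝ :=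
  sSup {x | ∃ s, ∃ a ∈ G₁.moves₁ s, ∃ b ∈ G₁.moves₂ s, ∃ t ∈ (G₁.δ s a b).support,
    x = G₁.prob s a b t / G₂.prob s a b t ∨ x = G₂.prob s a b t / G₁.prob s a b t} - 1

end ConcurrentGame

/-!
# Robustness of the parity values of Markov decision processes

In a player-1 MDP the value of a parity objective is the value of a reachability problem
(`ConcurrentGame.val_parityObj_eq_reachVal`) whose target, the union of the winning end components
(`FinMDP.winSet`), depends only on the supports of the transition probabilities. On the one hand,
by the conditional Borel–Cantelli lemma, under any strategy the set of states visited infinitely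
often is almost surely an end component, so that a play which meets the objective ends up in the
target (`ConcurrentGame.ae_infStates_subset_winSet`); the probability of that is bounded by any
superharmonic function which is `1` on the target. On the other hand, inside the target a
memoryless policy wins almost surely (`FinMDP.exists_winning_policy`).

The reachability value is treated as the limit of discounted values, for which linear systems have
unique solutions, maximum principles hold without any assumption on the graph, and stationary
policies are optimal by policy improvement (`FinMDP.exists_isDiscValue`). It therefore suffices to
compare the discounted hitting values of two Markov chains whose transition probabilities differ by
factors in `[a, b]`. Only the rows of non-target states matter, and these are changed one at a time:
as a function of a single row the value is a quotient of two linear forms with nonnegative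
coefficients, so that each change costs a factor of at most `b / a`
(`IsDirichletSol.le_of_row_change`), and the total factor is at most `(b / a) ^ (|S| - 1)`
(`IsDirichletSol.le_pow_mul`).

The ratio distance `r - 1` gives `b / a = r ^ 2`. An absolute error `d` is a relative error
`x = d / η` with respect to the first game, and gives `b / a = (1 + x) / (1 - x)`; this is slightly
more than `(1 + x) ^ 2`, but the exponent `|S| - 1` instead of `|S|` makes up for the difference as
long as the claimed bound is not trivial (`div_pow_le_one_add_pow`).

A pure memoryless strategy turns both games into MDPs without any choice, whose values are the
values of the strategy (`ConcurrentGame.val_restrict`). Hence these are close as well, and an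
optimal strategy of one game loses at most twice the error bound in the other.
-/

/-! ### Discounted chains and perturbation of their hitting values -/

/-- A nonnegative matrix whose row sums are at most `γ`. -/
structure IsSubstochastic {S : Type*} [Fintype S] (γ : ℝ) (P : S → S → ℝ) : Prop where
  nonneg : ∀ s t, 0 ≤ P s t
  sum_le : ∀ s, ∑ t, P s t ≤ γ

/-- The function `f` solves the Dirichlet problem for `P`: it equals `g` on the boundary `B` and
is `P`-harmonic off `B`. -/
def IsDirichletSol {S : Type*} [Fintype S] (B : Set S) (g : S → ℝ) (P : S → S → ℝ)
    (f : S → ℝ) : Prop :=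
  (∀ s ∈ B, f s = g s) ∧ ∀ s ∉ B, f s = ∑ t, P s t * f t

section Chain

variable {S : Type*} [Fintype S] {γ : ℝ} {P P' : S → S → ℝ} {B W : Set S} {g : S → ℝ}

/-- Minimum principle: look at a state where `x` is minimal. -/
lemma IsSubstochastic.nonneg_of_superharmonic (hP : IsSubstochastic γ P) (hγ : γ < 1)
    {x : S → ℝ} (hx : ∀ s, 0 ≤ x s ∨ ∑ t, P s t * x t ≤ x s) (s : S) : 0 ≤ x s := by
  obtain ⟨s₀, -, hmin⟩ := Finset.exists_min_image Finset.univ x ⟨s, Finset.mem_univ s⟩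
  refine le_trans ?_ (hmin s (Finset.mem_univ s))
  rcases hx s₀ with h | h
  · exact h
  by_contra hneg
  push Not at hneg
  have h1 : (∑ t, P s₀ t) * x s₀ ≤ ∑ t, P s₀ t * x t := by
    rw [Finset.sum_mul]
    exact Finset.sum_le_sum fun t _ =>
      mul_le_mul_of_nonneg_left (hmin t (Finset.mem_univ t)) (hP.nonneg s₀ t)
  have h2 := hP.sum_le s₀
  nlinarith

lemma IsSubstochastic.le_of_sub_of_super (hP : IsSubstochastic γ P) (hγ : γ < 1)
    {f h : S → ℝ} (hB : ∀ s ∈ B, f s ≤ h s) (hf : ∀ s ∉ B, f s ≤ ∑ t, P s t * f t)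
    (hh : ∀ s ∉ B, ∑ t, P s t * h t ≤ h s) (s : S) : f s ≤ h s := by
  have := hP.nonneg_of_superharmonic hγ (x := fun s => h s - f s) (fun s => ?_) s
  · linarith
  by_cases hs : s ∈ B
  · left; linarith [hB s hs]
  · right
    simp only [mul_sub, Finset.sum_sub_distrib]
    linarith [hf s hs, hh s hs]

lemma IsDirichletSol.unique (hP : IsSubstochastic γ P) (hγ : γ < 1) {f h : S → ℝ}
    (hf : IsDirichletSol B g P f) (hh : IsDirichletSol B g P h) : f = h := by
  funext s
  apply le_antisymm
  · exact hP.le_of_sub_of_super hγ (B := B) (fun s hs => by rw [hf.1 s hs, hh.1 s hs])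
      (fun s hs => (hf.2 s hs).le) (fun s hs => (hh.2 s hs).ge) s
  · exact hP.le_of_sub_of_super hγ (B := B) (fun s hs => by rw [hf.1 s hs, hh.1 s hs])
      (fun s hs => (hh.2 s hs).le) (fun s hs => (hf.2 s hs).ge) s

/-- By the minimum principle the linear map `f ↦ f - 1_{Bᶜ} P f` is injective, hence surjective. -/
lemma IsSubstochastic.exists_dirichletSol (hP : IsSubstochastic γ P) (hγ : γ < 1)
    (B : Set S) (g : S → ℝ) : ∃ f, IsDirichletSol B g P f := by
  classical
  let T : (S → ℝ) →ₗ[ℝ] (S → ℝ) :=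
    { toFun := fun f s => if s ∈ B then f s else f s - ∑ t, P s t * f t
      map_add' := fun f h => by
        funext s
        by_cases hs : s ∈ B
        · simp [hs]
        · simp [hs, mul_add, Finset.sum_add_distrib]; ring
      map_smul' := fun c f => by
        funext s
        by_cases hs : s ∈ B
        · simp [hs]
        · simp [hs, mul_sub, Finset.mul_sum, mul_left_comm] }
  have hinj : Function.Injective T := by
    rw [injective_iff_map_eq_zero]
    intro f hf
    have hf' : ∀ s, T f s = 0 := fun s => congrFun hf s
    refine IsDirichletSol.unique (B := B) (g := 0) hP hγ ⟨fun s hs => ?_, fun s hs => ?_⟩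
      ⟨fun s _ => rfl, fun s _ => by simp⟩
    · simpa [T, hs] using hf' s
    · have := hf' s
      simp only [T, LinearMap.coe_mk, AddHom.coe_mk, hs, if_false] at this
      linarith
  obtain ⟨f, hf⟩ := LinearMap.injective_iff_surjective.1 hinj (fun s => if s ∈ B then g s else 0)
  have hf' : ∀ s, T f s = if s ∈ B then g s else 0 := fun s => congrFun hf s
  refine ⟨f, fun s hs => ?_, fun s hs => ?_⟩
  · simpa [T, hs] using hf' s
  · have := hf' s
    simp only [T, LinearMap.coe_mk, AddHom.coe_mk, hs, if_false] at this
    linarith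

lemma IsDirichletSol.nonneg (hP : IsSubstochastic γ P) (hγ : γ < 1) {f : S → ℝ}
    (hf : IsDirichletSol B g P f) (hg : ∀ s, 0 ≤ g s) (s : S) : 0 ≤ f s :=
  hP.le_of_sub_of_super hγ (B := B) (f := 0) (fun s hs => by rw [hf.1 s hs]; exact hg s)
    (fun s _ => by simp) (fun s hs => (hf.2 s hs).ge) s

lemma IsDirichletSol.le_one (hP : IsSubstochastic γ P) (hγ : γ < 1) {f : S → ℝ}
    (hf : IsDirichletSol B g P f) (hg : ∀ s, g s ≤ 1) (s : S) : f s ≤ 1 :=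
  hP.le_of_sub_of_super hγ (B := B) (h := 1) (fun s hs => by rw [hf.1 s hs]; exact hg s)
    (fun s hs => (hf.2 s hs).le)
    (fun s _ => by simpa using (hP.sum_le s).trans hγ.le) s

/-- Changing a single row `u` of a discounted chain. The value at `u` is a quotient of two
linear forms with nonnegative coefficients in the `u`-th row: with `α` (resp. `β`) the discounted
probability of hitting `W` before `u` (resp. `u` before `W`), one has `f = α + f u * β` and
`f u * (1 - ∑ P u t β t) = ∑ P u t α t`. Hence the value changes by a factor at most `b / a`. -/
lemma IsDirichletSol.le_of_row_change (hP : IsSubstochastic γ P) (hP' : IsSubstochastic γ P')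
    (hγ : γ < 1) {a b : ℝ} (ha : 0 < a) (ha1 : a ≤ 1) (hb1 : 1 ≤ b) {u : S} (hu : u ∉ W)
    (hne : ∀ s ≠ u, P' s = P s) (hlo : ∀ t, a * P u t ≤ P' u t) (hhi : ∀ t, P' u t ≤ b * P u t)
    (hsum : ∑ t, P' u t = ∑ t, P u t) {f f' : S → ℝ}
    (hf : IsDirichletSol W 1 P f) (hf' : IsDirichletSol W 1 P' f') (s : S) :
    f' s ≤ b / a * f s := by
  classical
  obtain ⟨α, hα⟩ := hP.exists_dirichletSol hγ (insert u W) (Set.indicator W 1)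
  obtain ⟨β, hβ⟩ := hP.exists_dirichletSol hγ (insert u W) (Set.indicator {u} 1)
  have hind0 : ∀ (V : Set S) s, 0 ≤ Set.indicator V (1 : S → ℝ) s := fun V s =>
    Set.indicator_nonneg (fun _ _ => zero_le_one) s
  have hind1 : ∀ (V : Set S) s, Set.indicator V (1 : S → ℝ) s ≤ 1 := fun V s =>
    Set.indicator_le_self' (fun _ _ => zero_le_one) s
  have hα0 : ∀ t, 0 ≤ α t := hα.nonneg hP hγ (hind0 W)
  have hβ0 : ∀ t, 0 ≤ β t := hβ.nonneg hP hγ (hind0 {u})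
  have hβ1 : ∀ t, β t ≤ 1 := hβ.le_one hP hγ (hind1 {u})
  have hαu : α u = 0 := by rw [hα.1 u (Set.mem_insert _ _), Set.indicator_of_notMem hu]
  have hβu : β u = 1 := by rw [hβ.1 u (Set.mem_insert _ _)]; simp
  -- any solution for a matrix which agrees with `P` off `u` is `α + f u * β`
  have key : ∀ Q : S → S → ℝ, IsSubstochastic γ Q → (∀ s ≠ u, Q s = P s) → ∀ h : S → ℝ,
      IsDirichletSol W 1 Q h → h = fun t => α t + h u * β t := by
    intro Q _ hQne h hh
    refine IsDirichletSol.unique (B := insert u W) (g := h) hP hγ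
      ⟨fun _ _ => rfl, fun s hs => ?_⟩ ⟨fun s hs => ?_, fun s hs => ?_⟩
    · rw [Set.mem_insert_iff, not_or] at hs
      rw [← hQne s hs.1]; exact hh.2 s hs.2
    · change α s + h u * β s = h s
      rcases hs with rfl | hs
      · rw [hαu, hβu]; ring
      · have hsu : s ≠ u := fun h => hu (h ▸ hs)
        rw [hα.1 s (Set.mem_insert_of_mem _ hs), hβ.1 s (Set.mem_insert_of_mem _ hs), hh.1 s hs,
          Set.indicator_of_mem hs, Set.indicator_of_notMem (by simpa using hsu)]
        simp
    · simp only [mul_add, Finset.sum_add_distrib]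
      rw [hα.2 s hs, hβ.2 s hs, Finset.mul_sum]
      congr 1
      exact Finset.sum_congr rfl fun t _ => by ring
  have hfe := key P hP (fun _ _ => rfl) f hf
  have hfe' := key P' hP' hne f' hf'
  have hfu : f u = ∑ t, P u t * α t + f u * ∑ t, P u t * β t := by
    conv_lhs => rw [hf.2 u hu, hfe]
    simp only [mul_add, Finset.sum_add_distrib, Finset.mul_sum]
    congr 1
    exact Finset.sum_congr rfl fun t _ => by ring
  have hfu' : f' u = ∑ t, P' u t * α t + f' u * ∑ t, P' u t * β t := by
    conv_lhs => rw [hf'.2 u hu, hfe']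
    simp only [mul_add, Finset.sum_add_distrib, Finset.mul_sum]
    congr 1
    exact Finset.sum_congr rfl fun t _ => by ring
  have hf0 : ∀ t, 0 ≤ f t := hf.nonneg hP hγ (fun _ => zero_le_one)
  have hf'0 : ∀ t, 0 ≤ f' t := hf'.nonneg hP' hγ (fun _ => zero_le_one)
  have hnum : ∑ t, P' u t * α t ≤ b * ∑ t, P u t * α t := by
    rw [Finset.mul_sum]
    exact Finset.sum_le_sum fun t _ => by
      nlinarith [mul_le_mul_of_nonneg_right (hhi t) (hα0 t)]
  have hden : a * (1 - ∑ t, P u t * β t) ≤ 1 - ∑ t, P' u t * β t := by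
    have h1 : ∑ t, a * (P u t * (1 - β t)) ≤ ∑ t, P' u t * (1 - β t) :=
      Finset.sum_le_sum fun t _ => by
        nlinarith [mul_le_mul_of_nonneg_right (hlo t) (sub_nonneg.2 (hβ1 t))]
    rw [← Finset.mul_sum] at h1
    simp only [mul_sub, mul_one, Finset.sum_sub_distrib, hsum] at h1
    nlinarith [hP.sum_le u]
  have hpos : 0 < 1 - ∑ t, P u t * β t := by
    have : ∑ t, P u t * β t ≤ ∑ t, P u t := Finset.sum_le_sum fun t _ =>
      mul_le_of_le_one_right (hP.nonneg u t) (hβ1 t)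
    linarith [hP.sum_le u]
  have hval : f' u ≤ b / a * f u := by
    have h1 : f' u * (a * (1 - ∑ t, P u t * β t)) ≤ b * (f u * (1 - ∑ t, P u t * β t)) := by
      calc f' u * (a * (1 - ∑ t, P u t * β t)) ≤ f' u * (1 - ∑ t, P' u t * β t) :=
            mul_le_mul_of_nonneg_left hden (hf'0 u)
        _ = ∑ t, P' u t * α t := by linarith
        _ ≤ b * ∑ t, P u t * α t := hnum
        _ = b * (f u * (1 - ∑ t, P u t * β t)) := by congr 1; linarith
    have h2 : f' u * a ≤ b * f u := by
      refine le_of_mul_le_mul_right ?_ hpos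
      linarith
    rw [div_mul_eq_mul_div, le_div_iff₀ ha]
    exact h2
  have hba : 1 ≤ b / a := by rw [le_div_iff₀ ha]; linarith
  have e1 : f s = α s + f u * β s := congrFun hfe s
  have e2 : f' s = α s + f' u * β s := congrFun hfe' s
  rw [e1, e2]
  nlinarith [mul_le_mul_of_nonneg_right hval (hβ0 s), mul_le_mul_of_nonneg_right hba (hα0 s)]

/-- Perturbing the rows one after the other costs a factor `b / a` for each state off `W`. -/
lemma IsDirichletSol.le_pow_mul (hP : IsSubstochastic γ P) (hP' : IsSubstochastic γ P')
    (hγ : γ < 1) {a b : ℝ} (ha : 0 < a) (ha1 : a ≤ 1) (hb1 : 1 ≤ b)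
    (hlo : ∀ s t, a * P s t ≤ P' s t) (hhi : ∀ s t, P' s t ≤ b * P s t)
    (hsum : ∀ s, ∑ t, P' s t = ∑ t, P s t) (hW : W.Nonempty) {f f' : S → ℝ}
    (hf : IsDirichletSol W 1 P f) (hf' : IsDirichletSol W 1 P' f') (s : S) :
    f' s ≤ (b / a) ^ (Fintype.card S - 1) * f s := by
  classical
  let mix : Finset S → S → S → ℝ := fun T s => if s ∈ T then P' s else P s
  have hmix : ∀ T, IsSubstochastic γ (mix T) := fun T =>
    ⟨fun s t => by by_cases h : s ∈ T <;> simp [mix, h, hP.nonneg, hP'.nonneg],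
      fun s => by by_cases h : s ∈ T <;> simp [mix, h, hP.sum_le, hP'.sum_le]⟩
  have hba : 1 ≤ b / a := by rw [le_div_iff₀ ha]; linarith
  have main : ∀ T : Finset S, (∀ s ∈ T, s ∉ W) → ∀ h, IsDirichletSol W 1 (mix T) h →
      ∀ s, h s ≤ (b / a) ^ T.card * f s := by
    intro T
    induction T using Finset.induction_on with
    | empty =>
      intro _ h hh s
      rw [IsDirichletSol.unique hP hγ (f := h) (h := f) (by simpa [mix] using hh) hf]
      simp
    | insert u T huT ih =>
      intro hT h hh s
      obtain ⟨h₀, hh₀⟩ := (hmix T).exists_dirichletSol hγ W 1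
      have h1 := ih (fun s hs => hT s (Finset.mem_insert_of_mem hs)) h₀ hh₀ s
      have h2 := IsDirichletSol.le_of_row_change (hmix T) (hmix (insert u T)) hγ ha ha1 hb1
        (hT u (Finset.mem_insert_self _ _))
        (fun s hs => by simp [mix, Finset.mem_insert, hs])
        (fun t => by simpa [mix, huT] using hlo u t) (fun t => by simpa [mix, huT] using hhi u t)
        (by simpa [mix, huT] using hsum u) hh₀ hh s
      rw [Finset.card_insert_of_notMem huT, pow_succ']
      calc h s ≤ b / a * h₀ s := h2
        _ ≤ b / a * ((b / a) ^ T.card * f s) := by gcongr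
        _ = _ := by ring
  have hT := main (Finset.univ.filter (· ∉ W)) (by simp) f'
    ⟨hf'.1, fun s hs => by simpa [mix, hs] using hf'.2 s hs⟩ s
  refine hT.trans ?_
  have hf0 : 0 ≤ f s := hf.nonneg hP hγ (fun _ => zero_le_one) s
  refine mul_le_mul_of_nonneg_right (pow_le_pow_right₀ hba ?_) hf0
  obtain ⟨w, hw⟩ := hW
  refine Nat.le_sub_one_of_lt (Finset.card_lt_univ_of_notMem (x := w) (by simpa using hw))

end Chain

/-! ### Discounted and undiscounted reachability values of a Markov decision process -/

/-- A Markov decision process, i.e. the one-player game that is left of a player-1 MDP once the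
forced moves of player 2 are absorbed into the transition function. -/
structure FinMDP (S A : Type*) where
  /-- the available moves -/
  moves : S → Finset A
  moves_nonempty : ∀ s, (moves s).Nonempty
  /-- the transition function -/
  step : S → A → PMF S

lemma PMF.sum_toReal_eq_one {S : Type*} [Fintype S] (q : PMF S) : ∑ t, (q t).toReal = 1 := by
  rw [← ENNReal.toReal_sum fun t _ => q.apply_ne_top t, ← tsum_fintype (L := .unconditional _),
    q.tsum_coe, ENNReal.toReal_one]

namespace FinMDP

variable {S A : Type*} [Fintype S] {M M₁ M₂ : FinMDP S A} {W : Set S} {γ : ℝ} {v : S → ℝ}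

/-- The expectation of `v` at the next state. -/
noncomputable def expect (M : FinMDP S A) (v : S → ℝ) (s : S) (a : A) : ℝ :=
  ∑ t, (M.step s a t).toReal * v t

lemma expect_mono {v w : S → ℝ} (h : ∀ t, v t ≤ w t) (s : S) (a : A) :
    M.expect v s a ≤ M.expect w s a :=
  Finset.sum_le_sum fun t _ => mul_le_mul_of_nonneg_left (h t) ENNReal.toReal_nonneg

lemma expect_nonneg (h : ∀ t, 0 ≤ v t) (s : S) (a : A) : 0 ≤ M.expect v s a :=
  Finset.sum_nonneg fun t _ => mul_nonneg ENNReal.toReal_nonneg (h t)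

lemma expect_const (c : ℝ) (s : S) (a : A) : M.expect (fun _ => c) s a = c := by
  rw [expect, ← Finset.sum_mul, PMF.sum_toReal_eq_one, one_mul]

/-- The `γ`-discounted transition matrix of the stationary policy `σ`. -/
noncomputable def discMatrix (M : FinMDP S A) (γ : ℝ) (σ : S → A) (s t : S) : ℝ :=
  γ * (M.step s (σ s) t).toReal

lemma sum_discMatrix_mul (M : FinMDP S A) (γ : ℝ) (σ : S → A) (v : S → ℝ) (s : S) :
    ∑ t, M.discMatrix γ σ s t * v t = γ * M.expect v s (σ s) := by
  simp only [discMatrix, expect, Finset.mul_sum, mul_assoc]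

lemma sum_discMatrix (M : FinMDP S A) (γ : ℝ) (σ : S → A) (s : S) :
    ∑ t, M.discMatrix γ σ s t = γ := by
  simp only [discMatrix, ← Finset.mul_sum, PMF.sum_toReal_eq_one, mul_one]

lemma isSubstochastic_discMatrix (M : FinMDP S A) (hγ : 0 ≤ γ) (σ : S → A) :
    IsSubstochastic γ (M.discMatrix γ σ) :=
  ⟨fun _ _ => mul_nonneg hγ ENNReal.toReal_nonneg, fun s => (M.sum_discMatrix γ σ s).le⟩

/-- `v` is the value function of the `γ`-discounted reachability problem with target `W`, i.e. it
satisfies the Bellman equation. -/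
structure IsDiscValue (M : FinMDP S A) (W : Set S) (γ : ℝ) (v : S → ℝ) : Prop where
  eq_one : ∀ s ∈ W, v s = 1
  expect_le : ∀ s ∉ W, ∀ a ∈ M.moves s, γ * M.expect v s a ≤ v s
  exists_eq : ∀ s ∉ W, ∃ a ∈ M.moves s, v s = γ * M.expect v s a

/-- A discounted value is the value of a stationary greedy policy. -/
lemma IsDiscValue.exists_policy (hv : M.IsDiscValue W γ v) :
    ∃ σ : S → A, (∀ s, σ s ∈ M.moves s) ∧ IsDirichletSol W 1 (M.discMatrix γ σ) v := by
  classical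
  have : ∀ s, ∃ a ∈ M.moves s, s ∉ W → v s = γ * M.expect v s a := fun s => by
    by_cases hs : s ∈ W
    · obtain ⟨a, ha⟩ := M.moves_nonempty s
      exact ⟨a, ha, fun h => absurd hs h⟩
    · obtain ⟨a, ha, h⟩ := hv.exists_eq s hs
      exact ⟨a, ha, fun _ => h⟩
  choose σ hσ hσv using this
  exact ⟨σ, hσ, hv.eq_one, fun s hs => by rw [sum_discMatrix_mul]; exact hσv s hs⟩

lemma IsDiscValue.policy_le (hv : M.IsDiscValue W γ v) (hγ0 : 0 ≤ γ) (hγ : γ < 1) {σ : S → A}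
    (hσ : ∀ s, σ s ∈ M.moves s) {f : S → ℝ} (hf : IsDirichletSol W 1 (M.discMatrix γ σ) f)
    (s : S) : f s ≤ v s :=
  (M.isSubstochastic_discMatrix hγ0 σ).le_of_sub_of_super hγ (B := W)
    (fun s hs => by rw [hf.1 s hs, hv.eq_one s hs]; rfl) (fun s hs => (hf.2 s hs).le)
    (fun s hs => by rw [sum_discMatrix_mul]; exact hv.expect_le s hs _ (hσ s)) s

lemma IsDiscValue.nonneg (hv : M.IsDiscValue W γ v) (hγ0 : 0 ≤ γ) (hγ : γ < 1) (s : S) :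
    0 ≤ v s := by
  obtain ⟨σ, -, h⟩ := hv.exists_policy
  exact h.nonneg (M.isSubstochastic_discMatrix hγ0 σ) hγ (fun _ => zero_le_one) s

lemma IsDiscValue.le_one (hv : M.IsDiscValue W γ v) (hγ0 : 0 ≤ γ) (hγ : γ < 1) (s : S) :
    v s ≤ 1 := by
  obtain ⟨σ, -, h⟩ := hv.exists_policy
  exact h.le_one (M.isSubstochastic_discMatrix hγ0 σ) hγ (fun _ => le_rfl) s

/-- Policy improvement: among the finitely many stationary policies, take one whose value function
has the largest sum; if the Bellman equation failed at a state, switching the move there would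
increase that sum. -/
lemma exists_isDiscValue [Finite A] (M : FinMDP S A) (W : Set S) (hγ0 : 0 ≤ γ) (hγ : γ < 1) :
    ∃ v, M.IsDiscValue W γ v := by
  classical
  choose F hF using fun σ : S → A =>
    (M.isSubstochastic_discMatrix hγ0 σ).exists_dirichletSol hγ W 1
  choose σ₀ hσ₀ using M.moves_nonempty
  obtain ⟨σ, hσ, hmax⟩ := Set.exists_max_image {σ : S → A | ∀ s, σ s ∈ M.moves s}
    (fun σ => ∑ s, F σ s) (Set.toFinite _) ⟨σ₀, hσ₀⟩
  refine ⟨F σ, (hF σ).1, fun u hu a ha => ?_, fun s hs => ⟨σ s, hσ s, ?_⟩⟩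
  · by_contra! hlt
    let σ' := Function.update σ u a
    have hσ' : ∀ s, σ' s ∈ M.moves s := fun s => by
      rcases eq_or_ne s u with rfl | h
      · simpa [σ'] using ha
      · simpa [σ', h] using hσ s
    have hsub : ∀ s ∉ W, F σ s ≤ γ * M.expect (F σ) s (σ' s) := fun s hs => by
      rcases eq_or_ne s u with rfl | h
      · simpa [σ'] using hlt.le
      · rw [show σ' s = σ s from Function.update_of_ne h _ _, ← sum_discMatrix_mul]
        exact ((hF σ).2 s hs).le
    have hle : ∀ s, F σ s ≤ F σ' s :=
      (M.isSubstochastic_discMatrix hγ0 σ').le_of_sub_of_super hγ (B := W)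
        (fun s hs => by rw [(hF σ).1 s hs, (hF σ').1 s hs])
        (fun s hs => by rw [sum_discMatrix_mul]; exact hsub s hs)
        (fun s hs => ((hF σ').2 s hs).ge)
    have hltu : F σ u < F σ' u := by
      refine hlt.trans_le ?_
      rw [(hF σ').2 u hu, sum_discMatrix_mul, show σ' u = a from Function.update_self _ _ _]
      exact mul_le_mul_of_nonneg_left (expect_mono hle u a) hγ0
    exact absurd (hmax σ' hσ')
      (not_le.2 (Finset.sum_lt_sum (fun s _ => hle s) ⟨u, Finset.mem_univ u, hltu⟩))
  · rw [← sum_discMatrix_mul]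
    exact (hF σ).2 s hs

/-- Discounted values increase with the discount factor. -/
lemma IsDiscValue.mono {γ' : ℝ} {v' : S → ℝ} (hv : M.IsDiscValue W γ v)
    (hv' : M.IsDiscValue W γ' v') (hγ0 : 0 ≤ γ) (hγγ : γ ≤ γ') (hγ : γ' < 1) (s : S) :
    v s ≤ v' s := by
  obtain ⟨σ, hσ, h⟩ := hv.exists_policy
  refine (M.isSubstochastic_discMatrix hγ0 σ).le_of_sub_of_super (hγγ.trans_lt hγ) (B := W)
    (fun s hs => by rw [hv.eq_one s hs, hv'.eq_one s hs]) (fun s hs => (h.2 s hs).le)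
    (fun s hs => ?_) s
  rw [sum_discMatrix_mul]
  exact (mul_le_mul_of_nonneg_right hγγ
    (expect_nonneg (hv'.nonneg (hγ0.trans hγγ) hγ) _ _)).trans (hv'.expect_le s hs _ (hσ s))

/-- The discounted values of two MDPs with comparable transition probabilities. -/
lemma IsDiscValue.le_pow_mul {v₁ v₂ : S → ℝ} (h₁ : M₁.IsDiscValue W γ v₁)
    (h₂ : M₂.IsDiscValue W γ v₂) (hγ0 : 0 ≤ γ) (hγ : γ < 1) (hW : W.Nonempty)
    (hmoves : M₁.moves = M₂.moves) {a b : ℝ} (ha : 0 < a) (ha1 : a ≤ 1) (hb1 : 1 ≤ b)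
    (hlo : ∀ s, ∀ x ∈ M₁.moves s, ∀ t, a * (M₁.step s x t).toReal ≤ (M₂.step s x t).toReal)
    (hhi : ∀ s, ∀ x ∈ M₁.moves s, ∀ t, (M₂.step s x t).toReal ≤ b * (M₁.step s x t).toReal)
    (s : S) : v₂ s ≤ (b / a) ^ (Fintype.card S - 1) * v₁ s := by
  obtain ⟨σ, hσ, hσv⟩ := h₂.exists_policy
  rw [← hmoves] at hσ
  obtain ⟨f, hf⟩ := (M₁.isSubstochastic_discMatrix hγ0 σ).exists_dirichletSol hγ W 1
  have h := IsDirichletSol.le_pow_mul (M₁.isSubstochastic_discMatrix hγ0 σ)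
    (M₂.isSubstochastic_discMatrix hγ0 σ) hγ ha ha1 hb1
    (fun s t => by
      have := mul_le_mul_of_nonneg_left (hlo s _ (hσ s) t) hγ0
      simp only [discMatrix]; linarith)
    (fun s t => by
      have := mul_le_mul_of_nonneg_left (hhi s _ (hσ s) t) hγ0
      simp only [discMatrix]; linarith)
    (fun s => by rw [sum_discMatrix, sum_discMatrix]) hW hf hσv s
  have : 0 ≤ (b / a) ^ (Fintype.card S - 1) := by positivity
  exact h.trans (mul_le_mul_of_nonneg_left (h₁.policy_le hγ0 hγ hσ hf s) this)

/-- A sequence of discount factors increasing to `1`. -/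
noncomputable def discount (k : ℕ) : ℝ := 1 - 1 / ((k : ℝ) + 1)

lemma discount_nonneg (k : ℕ) : 0 ≤ discount k := by
  have : 1 / ((k : ℝ) + 1) ≤ 1 := by
    rw [div_le_one (by positivity)]; linarith [(Nat.cast_nonneg k : (0 : ℝ) ≤ k)]
  simpa [discount] using this

lemma discount_lt_one (k : ℕ) : discount k < 1 := by
  have : 0 < 1 / ((k : ℝ) + 1) := by positivity
  simp only [discount]; linarith

lemma discount_mono : Monotone discount := fun k l h => by
  have := Nat.one_div_le_one_div (α := ℝ) h
  simp only [discount]; linarith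

lemma tendsto_discount : Tendsto discount atTop (nhds 1) := by
  have := (tendsto_one_div_add_atTop_nhds_zero_nat (𝕜 := ℝ)).const_sub 1
  rwa [sub_zero] at this

variable [Finite A]

/-- The discounted value function along the sequence `discount`. -/
noncomputable def discVal (M : FinMDP S A) (W : Set S) (k : ℕ) : S → ℝ :=
  (M.exists_isDiscValue W (discount_nonneg k) (discount_lt_one k)).choose

lemma isDiscValue_discVal (M : FinMDP S A) (W : Set S) (k : ℕ) :
    M.IsDiscValue W (discount k) (M.discVal W k) :=
  (M.exists_isDiscValue W (discount_nonneg k) (discount_lt_one k)).choose_spec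

lemma discVal_nonneg (k : ℕ) (s : S) : 0 ≤ M.discVal W k s :=
  (M.isDiscValue_discVal W k).nonneg (discount_nonneg k) (discount_lt_one k) s

lemma discVal_le_one (k : ℕ) (s : S) : M.discVal W k s ≤ 1 :=
  (M.isDiscValue_discVal W k).le_one (discount_nonneg k) (discount_lt_one k) s

/-- The reachability value of the target `W`, as the limit of the discounted values. -/
noncomputable def reachVal (M : FinMDP S A) (W : Set S) (s : S) : ℝ := ⨆ k, M.discVal W k s

lemma bddAbove_discVal (s : S) : BddAbove (Set.range fun k => M.discVal W k s) :=
  ⟨1, by rintro _ ⟨k, rfl⟩; exact discVal_le_one k s⟩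

lemma discVal_le_reachVal (k : ℕ) (s : S) : M.discVal W k s ≤ M.reachVal W s :=
  le_ciSup (bddAbove_discVal s) k

lemma reachVal_nonneg (s : S) : 0 ≤ M.reachVal W s :=
  (discVal_nonneg 0 s).trans (discVal_le_reachVal 0 s)

lemma reachVal_le_one (s : S) : M.reachVal W s ≤ 1 := ciSup_le fun k => discVal_le_one k s

lemma reachVal_eq_one {s : S} (hs : s ∈ W) : M.reachVal W s = 1 := by
  simp [reachVal, (M.isDiscValue_discVal W _).eq_one s hs]

lemma tendsto_discVal (s : S) :
    Tendsto (fun k => M.discVal W k s) atTop (nhds (M.reachVal W s)) :=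
  tendsto_atTop_ciSup (fun k l h => (M.isDiscValue_discVal W k).mono (M.isDiscValue_discVal W l)
    (discount_nonneg k) (discount_mono h) (discount_lt_one l) s) (bddAbove_discVal s)

/-- The reachability value is superharmonic under all available moves. -/
lemma expect_reachVal_le (s : S) {a : A} (ha : a ∈ M.moves s) :
    M.expect (M.reachVal W) s a ≤ M.reachVal W s := by
  by_cases hs : s ∈ W
  · rw [reachVal_eq_one hs, ← expect_const (M := M) 1 s a]
    exact expect_mono reachVal_le_one s a
  · have h1 : Tendsto (fun k => discount k * M.expect (M.discVal W k) s a) atTop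
        (nhds (1 * M.expect (M.reachVal W) s a)) :=
      tendsto_discount.mul (tendsto_finsetSum _ fun t _ => (tendsto_discVal t).const_mul _)
    rw [one_mul] at h1
    exact le_of_tendsto_of_tendsto' h1 (tendsto_discVal s) fun k =>
      (M.isDiscValue_discVal W k).expect_le s hs a ha

lemma reachVal_of_empty (s : S) : M.reachVal ∅ s = 0 := by
  have h : ∀ k, M.discVal ∅ k s = 0 := fun k => by
    obtain ⟨σ, -, h⟩ := (M.isDiscValue_discVal ∅ k).exists_policy
    have hP := M.isSubstochastic_discMatrix (discount_nonneg k) σ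
    exact congrFun (h.unique hP (discount_lt_one k) (h := 0) ⟨by simp, by simp⟩) s
  simp [reachVal, h]

lemma reachVal_le_pow_mul (hmoves : M₁.moves = M₂.moves) {a b : ℝ} (ha : 0 < a) (ha1 : a ≤ 1)
    (hb1 : 1 ≤ b)
    (hlo : ∀ s, ∀ x ∈ M₁.moves s, ∀ t, a * (M₁.step s x t).toReal ≤ (M₂.step s x t).toReal)
    (hhi : ∀ s, ∀ x ∈ M₁.moves s, ∀ t, (M₂.step s x t).toReal ≤ b * (M₁.step s x t).toReal)
    (s : S) : M₂.reachVal W s ≤ (b / a) ^ (Fintype.card S - 1) * M₁.reachVal W s := by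
  rcases W.eq_empty_or_nonempty with rfl | hW
  · simp [reachVal_of_empty]
  · have hpos : 0 ≤ (b / a) ^ (Fintype.card S - 1) := by positivity
    exact ciSup_le fun k => ((M₁.isDiscValue_discVal W k).le_pow_mul (M₂.isDiscValue_discVal W k)
      (discount_nonneg k) (discount_lt_one k) hW hmoves ha ha1 hb1 hlo hhi s).trans
      (mul_le_mul_of_nonneg_left (discVal_le_reachVal k s) hpos)

end FinMDP

/-! ### One-step conditional expectations and the conditional Borel–Cantelli lemma -/

lemma infStates_nonempty {S : Type*} [Finite S] (ω : ℕ → S) : (infStates ω).Nonempty := by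
  by_contra h
  rw [Set.not_nonempty_iff_eq_empty, Set.eq_empty_iff_forall_notMem] at h
  simp only [infStates, Set.mem_ofPred_eq, not_frequently] at h
  obtain ⟨n, hn⟩ := (eventually_all.2 h).exists
  exact hn (ω n) rfl

lemma eventually_mem_infStates {S : Type*} [Finite S] (ω : ℕ → S) :
    ∀ᶠ n in atTop, ω n ∈ infStates ω := by
  have : ∀ s : S, ∀ᶠ n in atTop, ω n = s → s ∈ infStates ω := fun s => by
    by_cases hs : s ∈ infStates ω
    · exact Eventually.of_forall fun _ _ => hs
    · filter_upwards [not_frequently.1 hs] with n hn h using absurd h hn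
  filter_upwards [eventually_all.2 this] with n hn using hn _ rfl

namespace ConcurrentGame

/-- The conditional probability that the state at time `n + 1` is `t`, given the first `n + 1`
states of `ω`. -/
noncomputable def nextProb {S A : Type*} (G : ConcurrentGame S A) (π₁ π₂ : Strategy S A)
    (n : ℕ) (ω : ℕ → S) (t : S) : ℝ :=
  (G.next π₁ π₂ (Preorder.frestrictLe (π := fun _ => S) n ω) t).toReal

lemma nextProb_nonneg {S A : Type*} (G : ConcurrentGame S A) (π₁ π₂ : Strategy S A)
    (n : ℕ) (ω : ℕ → S) (t : S) : 0 ≤ G.nextProb π₁ π₂ n ω t :=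
  ENNReal.toReal_nonneg

variable {S A : Type*} [Fintype S] [MeasurableSpace S] [DiscreteMeasurableSpace S]
  (G : ConcurrentGame S A) (π₁ π₂ : Strategy S A) (s : S)

instance : IsProbabilityMeasure (G.law π₁ π₂ s) := by
  unfold law; infer_instance

lemma integrable_transition (μ : Measure (ℕ → S)) [IsFiniteMeasure μ] (g : S → S → ℝ) (n : ℕ) :
    Integrable (fun ω : ℕ → S => g (ω n) (ω (n + 1))) μ := by
  have hm : Measurable fun ω : ℕ → S => (ω n, ω (n + 1)) := by fun_prop
  have h : Integrable (fun x : S × S => g x.1 x.2) (μ.map fun ω => (ω n, ω (n + 1))) :=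
    Integrable.of_finite
  exact h.comp_measurable hm

lemma condExp_transition (g : S → S → ℝ) (n : ℕ) :
    (G.law π₁ π₂ s)[fun ω => g (ω n) (ω (n + 1)) | Filtration.piLE (X := fun _ => S) n]
      =ᵐ[G.law π₁ π₂ s] fun ω => ∑ t, G.nextProb π₁ π₂ n ω t * g (ω n) t := by
  have h := Kernel.condExp_traj (κ := G.stepKernel π₁ π₂) (X := fun _ => S) (Nat.zero_le n)
    (integrable_transition (G.law π₁ π₂ s) g n)
  refine h.trans (Eventually.of_forall fun ω => ?_)
  have hm : ∀ f : (ℕ → S) → ℝ, Measurable f → AEStronglyMeasurable f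
      (Kernel.traj (X := fun _ => S) (G.stepKernel π₁ π₂) n
        (Preorder.frestrictLe (π := fun _ => S) n ω)) :=
    fun f hf => hf.aestronglyMeasurable
  have hg : Measurable fun ω : ℕ → S => g (ω n) (ω (n + 1)) :=
    (measurable_of_countable fun x : S × S => g x.1 x.2).comp
      (by fun_prop : Measurable fun ω : ℕ → S => (ω n, ω (n + 1)))
  beta_reduce
  rw [Kernel.integral_traj _ (hm _ hg)]
  simp only [Function.updateFinset, Finset.mem_Iic, le_refl, dite_true, add_le_iff_nonpos_right,
    nonpos_iff_eq_zero, one_ne_zero, dite_false, Preorder.frestrictLe_apply]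
  have hmap := integral_map (μ := Kernel.traj (X := fun _ => S) (G.stepKernel π₁ π₂) n
        (Preorder.frestrictLe (π := fun _ => S) n ω)) (φ := fun ω => ω (n + 1)) (f := g (ω n))
        (measurable_pi_apply (n + 1)).aemeasurable (measurable_of_countable _).aestronglyMeasurable
  rw [← hmap, ← Kernel.map_apply _ (by fun_prop), Kernel.map_traj_succ_self]
  exact PMF.integral_eq_sum _ _

lemma integral_transition (g : S → S → ℝ) (n : ℕ) :
    ∫ ω, g (ω n) (ω (n + 1)) ∂(G.law π₁ π₂ s) =
      ∫ ω, ∑ t, G.nextProb π₁ π₂ n ω t * g (ω n) t ∂(G.law π₁ π₂ s) := by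
  rw [← integral_condExp ((Filtration.piLE (X := fun _ => S)).le n)]
  exact integral_congr_ae (G.condExp_transition π₁ π₂ s g n)

lemma integrable_sum_nextProb (g : S → S → ℝ) (n : ℕ) :
    Integrable (fun ω => ∑ t, G.nextProb π₁ π₂ n ω t * g (ω n) t) (G.law π₁ π₂ s) :=
  (integrable_condExp (m := Filtration.piLE (X := fun _ => S) n)).congr
    (G.condExp_transition π₁ π₂ s g n)

open scoped Classical in
/-- Lévy's conditional Borel–Cantelli lemma for the transitions of a play: the transition from `x`
to `t` is taken infinitely often iff its conditional probabilities have an infinite sum. -/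
lemma ae_frequently_transition_iff :
    ∀ᵐ ω ∂(G.law π₁ π₂ s), ∀ x t : S, (∃ᶠ n in atTop, ω n = x ∧ ω (n + 1) = t) ↔
      Tendsto (fun n => ∑ k ∈ Finset.range n, if ω k = x then G.nextProb π₁ π₂ k ω t else 0)
        atTop atTop := by
  rw [ae_all_iff]; intro x; rw [ae_all_iff]; intro t
  let E : ℕ → Set (ℕ → S) := fun n =>
    match n with
    | 0 => ∅
    | n + 1 => {ω | ω n = x ∧ ω (n + 1) = t}
  have hE : ∀ n, MeasurableSet[Filtration.piLE (X := fun _ => S) n] (E n) := by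
    rintro (_ | n)
    · exact @MeasurableSet.empty _ (Filtration.piLE (X := fun _ => S) 0)
    · rw [Filtration.piLE_eq_comap_frestrictLe]
      exact ⟨{h | h ⟨n, Finset.mem_Iic.2 n.le_succ⟩ = x ∧
        h ⟨n + 1, Finset.mem_Iic.2 le_rfl⟩ = t}, MeasurableSet.of_discrete, rfl⟩
  have hBC := ae_mem_limsup_atTop_iff (G.law π₁ π₂ s) hE
  have hcond : ∀ᵐ ω ∂(G.law π₁ π₂ s), ∀ n,
      ((G.law π₁ π₂ s)[(E (n + 1)).indicator (1 : (ℕ → S) → ℝ) |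
        Filtration.piLE (X := fun _ => S) n]) ω =
      if ω n = x then G.nextProb π₁ π₂ n ω t else 0 := by
    rw [ae_all_iff]; intro n
    have h := G.condExp_transition π₁ π₂ s (fun y z => if y = x ∧ z = t then 1 else 0) n
    have he : (E (n + 1)).indicator (1 : (ℕ → S) → ℝ) =
        fun ω => if ω n = x ∧ ω (n + 1) = t then 1 else 0 := by
      funext ω
      simp [E, Set.indicator_apply]
    rw [he]
    filter_upwards [h] with ω hω
    rw [hω]
    by_cases hx : ω n = x <;> simp [hx]
  filter_upwards [hBC, hcond] with ω h1 h2
  simp only [h2] at h1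
  rw [← h1, mem_limsup_iff_frequently_mem]
  refine ⟨fun h => ?_, fun h => ?_⟩
  · rw [frequently_atTop] at h ⊢
    intro a
    obtain ⟨b, hb, hb'⟩ := h a
    exact ⟨b + 1, by omega, hb'⟩
  · rw [frequently_atTop] at h ⊢
    intro a
    obtain ⟨b, hb, hb'⟩ := h (a + 1)
    obtain ⟨b, rfl⟩ : ∃ c, b = c + 1 := ⟨b - 1, by omega⟩
    exact ⟨b, by omega, hb'⟩

lemma ae_zero_eq : ∀ᵐ ω ∂(G.law π₁ π₂ s), ω 0 = s := by
  have h := Kernel.traj_map_frestrictLe_of_le (X := fun _ => S) (κ := G.stepKernel π₁ π₂)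
    (le_refl 0)
  have h2 : (G.law π₁ π₂ s).map (Preorder.frestrictLe (π := fun _ => S) 0) =
      Measure.dirac (fun _ => s) := by
    rw [law, ← Kernel.map_apply _ (by fun_prop), h, Kernel.deterministic_apply]
    rfl
  refine ae_of_ae_map (f := Preorder.frestrictLe (π := fun _ => S) 0)
    (p := fun h : History S 0 => h.last = s) (by fun_prop) ?_
  rw [h2, ae_dirac_eq]
  exact rfl

lemma measurableSet_parity (p : S → ℕ) : MeasurableSet (parity p) := by
  have h1 : ∀ s : S, MeasurableSet {ω : ℕ → S | s ∈ infStates ω} := fun s => by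
    have : {ω : ℕ → S | s ∈ infStates ω} = limsup (fun n => {ω : ℕ → S | ω n = s}) atTop := by
      ext ω; rw [mem_limsup_iff_frequently_mem]; rfl
    rw [this]
    exact MeasurableSet.measurableSet_limsup fun n =>
      measurableSet_eq_fun (measurable_pi_apply n) measurable_const
  have h2 : ∀ C : Set S, MeasurableSet {ω : ℕ → S | infStates ω = C} := fun C => by
    have : {ω : ℕ → S | infStates ω = C} = ⋂ s : S, {ω | s ∈ infStates ω ↔ s ∈ C} := by
      ext ω; simp [Set.ext_iff]
    rw [this]
    exact MeasurableSet.iInter fun s => (h1 s).iff (MeasurableSet.const _)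
  have : parity p = ⋃ C ∈ {C : Set S | Even (sInf (p '' C))}, {ω | infStates ω = C} := by
    ext ω; simp [parity]
  rw [this]
  exact MeasurableSet.biUnion (Set.to_countable _) fun C _ => h2 C

lemma integral_parityObj (p : S → ℕ) (μ : Measure (ℕ → S)) :
    ∫ ω, parityObj p ω ∂μ = μ.real (parity p) :=
  integral_indicator_one (measurableSet_parity p)

end ConcurrentGame

/-! ### The almost surely winning set of a parity objective -/

/-- A transition property that holds infinitely often holds for a transition which is taken
infinitely often. -/
lemma exists_frequently_transition {S : Type*} [Finite S] {ω : ℕ → S} {R : S → S → Prop}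
    (h : ∃ᶠ n in atTop, R (ω n) (ω (n + 1))) :
    ∃ x t, R x t ∧ ∃ᶠ n in atTop, ω n = x ∧ ω (n + 1) = t := by
  by_contra! hc
  have h2 : ∀ x t, ∀ᶠ n in atTop, R x t → ¬(ω n = x ∧ ω (n + 1) = t) := fun x t => by
    by_cases hR : R x t
    · filter_upwards [hc x t hR] with n hn _ h using hn h.1 h.2
    · exact Eventually.of_forall fun _ h => absurd h hR
  have h3 := eventually_all.2 fun x => eventually_all.2 (h2 x)
  obtain ⟨n, hn, hn'⟩ := (h.and_eventually h3).exists
  exact hn' _ _ hn ⟨rfl, rfl⟩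

lemma mem_infStates_of_frequently_transition {S : Type*} {ω : ℕ → S} {x t : S}
    (h : ∃ᶠ n in atTop, ω n = x ∧ ω (n + 1) = t) : x ∈ infStates ω ∧ t ∈ infStates ω := by
  refine ⟨h.mono fun _ h => h.1, ?_⟩
  change ∃ᶠ n in atTop, ω n = t
  rw [frequently_atTop] at h ⊢
  intro a
  obtain ⟨b, hb, -, hb'⟩ := h a
  exact ⟨b + 1, by omega, hb'⟩

namespace FinMDP

variable {S A : Type*} {M : FinMDP S A} {p : S → ℕ} {C : Set S} {m : S}

/-- A winning end component `C` with a distinguished state `m` of minimal, even priority: some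
policy stays in `C`, and from every state of `C` it has a positive probability of getting closer
to `m`, as measured by a rank function. The condition involves the supports of the transition
probabilities only. -/
structure IsWinningPair (M : FinMDP S A) (p : S → ℕ) (C : Set S) (m : S) : Prop where
  mem : m ∈ C
  even : Even (p m)
  le : ∀ s ∈ C, p m ≤ p s
  exists_rank : ∃ (σ : S → A) (d : S → ℕ), ∀ s ∈ C, σ s ∈ M.moves s ∧
    (M.step s (σ s)).support ⊆ C ∧ (s = m ∨ ∃ t ∈ (M.step s (σ s)).support, d t < d s)

/-- The union of all winning end components. -/
def winSet (M : FinMDP S A) (p : S → ℕ) : Set S :=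
  {s | ∃ C m, M.IsWinningPair p C m ∧ s ∈ C}

lemma winSet_subset_of_support_eq {M₁ M₂ : FinMDP S A} (hmoves : M₁.moves = M₂.moves)
    (hsupp : ∀ s, ∀ a ∈ M₁.moves s, (M₁.step s a).support = (M₂.step s a).support) (p : S → ℕ) :
    M₁.winSet p ⊆ M₂.winSet p := by
  rintro s ⟨C, m, h, hs⟩
  obtain ⟨σ, d, hσ⟩ := h.exists_rank
  refine ⟨C, m, ⟨h.mem, h.even, h.le, σ, d, fun s hs => ?_⟩, hs⟩
  obtain ⟨h1, h2, h3⟩ := hσ s hs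
  rw [← hmoves, ← hsupp s _ h1]
  exact ⟨h1, h2, h3⟩

/-- `m` can be reached from `x` in `k` steps through moves which cannot leave `C`. -/
def ReachIn (M : FinMDP S A) (C : Set S) (m : S) : ℕ → S → Prop
  | 0, x => x = m
  | k + 1, x => ∃ a ∈ M.moves x, (M.step x a).support ⊆ C ∧
      ∃ t ∈ (M.step x a).support, ReachIn M C m k t

/-- If every transition taken infinitely often is possible under a move which cannot leave the set
of states visited infinitely often, and the parity objective is met, then this set is a winning
end component. -/
lemma infStates_subset_winSet [Finite S] {ω : ℕ → S}
    (H : ∀ x t, (∃ᶠ n in atTop, ω n = x ∧ ω (n + 1) = t) →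
      ∃ a ∈ M.moves x, (M.step x a).support ⊆ infStates ω ∧ t ∈ (M.step x a).support)
    (hω : ω ∈ parity p) : infStates ω ⊆ M.winSet p := by
  classical
  have hne := infStates_nonempty ω
  obtain ⟨m, hmC, hm⟩ := Nat.sInf_mem (hne.image p)
  have hact : ∀ x ∈ infStates ω, ∃ a ∈ M.moves x, (M.step x a).support ⊆ infStates ω := by
    intro x hx
    obtain ⟨y, t, rfl, h⟩ := exists_frequently_transition (R := fun y _ => y = x) hx
    obtain ⟨a, ha, h1, -⟩ := H _ _ h
    exact ⟨a, ha, h1⟩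
  -- otherwise the play would leave infinitely often the states from which `m` is unreachable
  have hreach : ∀ x ∈ infStates ω, ∃ k, M.ReachIn (infStates ω) m k x := by
    by_contra! hc
    obtain ⟨x₀, hx₀, hx₀D⟩ := hc
    let D : Set S := {x | ∃ k, M.ReachIn (infStates ω) m k x}
    have hfreq : ∃ᶠ n in atTop, ω n ∉ D ∧ ω (n + 1) ∈ D := by
      by_contra hnf
      rw [not_frequently, eventually_atTop] at hnf
      obtain ⟨N, hN⟩ := hnf
      obtain ⟨n, hn, hnx⟩ := frequently_atTop.1 hx₀ N
      have hout : ∀ j, n ≤ j → ω j ∉ D := fun j hj => by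
        induction j, hj using Nat.le_induction with
        | base => rw [hnx]; rintro ⟨k, hk⟩; exact hx₀D k hk
        | succ j hj ih => exact fun h => hN j (hn.trans hj) ⟨ih, h⟩
      obtain ⟨j, hj, hjm⟩ := frequently_atTop.1 hmC n
      exact hout j hj ⟨0, hjm⟩
    obtain ⟨x, t, ⟨hx, k, hk⟩, hxt⟩ :=
      exists_frequently_transition (R := fun x t => x ∉ D ∧ t ∈ D) hfreq
    obtain ⟨a, ha, h1, h2⟩ := H x t hxt
    exact hx ⟨k + 1, a, ha, h1, t, h2, hk⟩
  let d : S → ℕ := fun x => sInf {k | M.ReachIn (infStates ω) m k x}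
  have hσ : ∀ x, ∃ a, x ∈ infStates ω → a ∈ M.moves x ∧ (M.step x a).support ⊆ infStates ω ∧
      (x = m ∨ ∃ t ∈ (M.step x a).support, d t < d x) := by
    intro x
    by_cases hx : x ∈ infStates ω
    · have hd : M.ReachIn (infStates ω) m (d x) x := Nat.sInf_mem (hreach x hx)
      rcases hdx : d x with _ | k
      · obtain ⟨a, ha, ha'⟩ := hact x hx
        rw [hdx] at hd
        exact ⟨a, fun _ => ⟨ha, ha', Or.inl hd⟩⟩
      · rw [hdx] at hd
        obtain ⟨a, ha, ha', t, ht, htk⟩ := hd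
        exact ⟨a, fun _ => ⟨ha, ha', Or.inr ⟨t, ht, Nat.lt_succ_of_le (Nat.sInf_le htk)⟩⟩⟩
    · obtain ⟨a, -⟩ := M.moves_nonempty x
      exact ⟨a, fun h => absurd h hx⟩
  choose σ hσ using hσ
  refine fun s hs => ⟨infStates ω, m, ⟨hmC, ?_, fun s hs => ?_, σ, d, hσ⟩, hs⟩
  · rw [hm]; exact hω
  · rw [hm]; exact Nat.sInf_le ⟨s, hs, rfl⟩

/-- A policy that wins from every state of the winning set. Each state follows the first winning
pair, in a fixed enumeration, whose component contains it; along a play the index of that pair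
decreases, so that it is eventually constant. -/
lemma exists_winning_policy [Finite S] (M : FinMDP S A) (p : S → ℕ) :
    ∃ σ : S → A, (∀ s ∈ M.winSet p, σ s ∈ M.moves s ∧ (M.step s (σ s)).support ⊆ M.winSet p) ∧
      ∀ ω : ℕ → S, (∃ N, ω N ∈ M.winSet p) →
        (∀ n, ω n ∈ M.winSet p → ω (n + 1) ∈ (M.step (ω n) (σ (ω n))).support) →
        (∀ x ∈ infStates ω, x ∈ M.winSet p →
          (M.step x (σ x)).support ⊆ infStates ω) → ω ∈ parity p := by
  classical
  obtain ⟨e, he⟩ := Countable.exists_injective_nat (Set S × S)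
  have hpr : ∀ s, ∃ q : Set S × S, s ∈ M.winSet p → M.IsWinningPair p q.1 q.2 ∧ s ∈ q.1 ∧
      ∀ q' : Set S × S, M.IsWinningPair p q'.1 q'.2 → s ∈ q'.1 → e q ≤ e q' := by
    intro s
    by_cases hs : s ∈ M.winSet p
    · obtain ⟨C, m, h, hsC⟩ := hs
      obtain ⟨q, hq, hmin⟩ := Set.exists_min_image
        {q : Set S × S | M.IsWinningPair p q.1 q.2 ∧ s ∈ q.1} e (Set.toFinite _) ⟨(C, m), h, hsC⟩
      exact ⟨q, fun _ => ⟨hq.1, hq.2, fun q' h1 h2 => hmin q' ⟨h1, h2⟩⟩⟩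
    · exact ⟨(∅, s), fun h => absurd h hs⟩
  choose pr hpr using hpr
  choose act d hact using fun (q : Set S × S) (hq : M.IsWinningPair p q.1 q.2) => hq.exists_rank
  choose b hb using M.moves_nonempty
  let σ : S → A := fun s => if h : M.IsWinningPair p (pr s).1 (pr s).2 then act (pr s) h s else b s
  have hσ : ∀ s (hs : s ∈ M.winSet p), σ s = act (pr s) (hpr s hs).1 s := fun s hs => by
    simp only [σ, dif_pos (hpr s hs).1]
  have hstep : ∀ s ∈ M.winSet p, (M.step s (σ s)).support ⊆ (pr s).1 := fun s hs => by
    rw [hσ s hs]; exact (hact (pr s) (hpr s hs).1 s (hpr s hs).2.1).2.1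
  have hsub : ∀ s ∈ M.winSet p, (pr s).1 ⊆ M.winSet p := fun s hs t ht =>
    ⟨_, _, (hpr s hs).1, ht⟩
  refine ⟨σ, fun s hs => ⟨?_, (hstep s hs).trans (hsub s hs)⟩, ?_⟩
  · rw [hσ s hs]; exact (hact (pr s) (hpr s hs).1 s (hpr s hs).2.1).1
  rintro ω ⟨N, hN⟩ hnext hinf
  have hstay : ∀ n, N ≤ n → ω n ∈ M.winSet p := fun n hn => by
    induction n, hn using Nat.le_induction with
    | base => exact hN
    | succ n hn ih => exact hsub _ ih (hstep _ ih (hnext n ih))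
  have hanti : ∀ n, N ≤ n → e (pr (ω (n + 1))) ≤ e (pr (ω n)) := fun n hn =>
    (hpr _ (hstay (n + 1) (by omega))).2.2 _ (hpr _ (hstay n hn)).1
      (hstep _ (hstay n hn) (hnext n (hstay n hn)))
  obtain ⟨n₀, hn₀, hconst⟩ : ∃ n₀, N ≤ n₀ ∧ ∀ n, n₀ ≤ n → pr (ω n) = pr (ω n₀) := by
    have hex : ∃ k n, N ≤ n ∧ e (pr (ω n)) = k := ⟨_, N, le_rfl, rfl⟩
    obtain ⟨n₀, hn₀, hk⟩ := Nat.find_spec hex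
    refine ⟨n₀, hn₀, fun n hn => he (le_antisymm ?_ ?_)⟩
    · induction n, hn using Nat.le_induction with
      | base => exact le_rfl
      | succ n hn ih => exact (hanti n (hn₀.trans hn)).trans ih
    · rw [hk]; exact Nat.find_min' hex ⟨n, hn₀.trans hn, rfl⟩
  have hinf' : ∀ x ∈ infStates ω, x ∈ M.winSet p ∧ pr x = pr (ω n₀) := fun x hx => by
    obtain ⟨n, hn, rfl⟩ := frequently_atTop.1 hx n₀
    exact ⟨hstay n (hn₀.trans hn), hconst n hn⟩
  have hq := (hpr _ (hstay n₀ hn₀)).1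
  have hinfC : infStates ω ⊆ (pr (ω n₀)).1 := fun x hx => by
    obtain ⟨h1, h2⟩ := hinf' x hx
    rw [← h2]; exact (hpr x h1).2.1
  have hσ' : ∀ x ∈ infStates ω, σ x = act (pr (ω n₀)) hq x := fun x hx => by
    obtain ⟨h1, h2⟩ := hinf' x hx
    rw [hσ x h1]
    congr 1
  -- a state of minimal rank among those visited infinitely often has to be the distinguished one
  obtain ⟨x, hx, hmin⟩ := Set.exists_min_image (infStates ω) (d (pr (ω n₀)) hq) (Set.toFinite _)
    (infStates_nonempty ω)
  have hxm : x = (pr (ω n₀)).2 := by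
    rcases (hact _ hq x (hinfC hx)).2.2 with h | ⟨t, ht, hlt⟩
    · exact h
    · rw [← hσ' x hx] at ht
      exact absurd (hmin t (hinf x hx (hinf' x hx).1 ht)) (not_le.2 hlt)
  have hsInf : sInf (p '' infStates ω) = p (pr (ω n₀)).2 := by
    refine le_antisymm (Nat.sInf_le ⟨x, hx, by rw [hxm]⟩) ?_
    obtain ⟨y, hy, hy'⟩ := Nat.sInf_mem ((infStates_nonempty ω).image p)
    rw [← hy']
    exact hq.le y (hinfC hy)
  change Even (sInf (p '' infStates ω))
  rw [hsInf]
  exact hq.even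

end FinMDP

/-! ### The value of a parity objective is a reachability value -/

lemma PMF.eq_pure_of_support_subset {A : Type*} {q : PMF A} {b : A} (h : q.support ⊆ {b}) :
    q = PMF.pure b := by
  have h1 : q b = 1 := (q.apply_eq_one_iff b).2
    (h.antisymm (by
      obtain ⟨a, ha⟩ := q.support_nonempty
      rintro _ rfl
      rwa [← show a = _ from h ha]))
  ext a
  by_cases ha : a = b
  · rw [ha, h1, PMF.pure_apply_self]
  · rw [PMF.pure_apply_of_ne _ _ ha, PMF.apply_eq_zero_iff]
    exact fun h' => ha (h h')

lemma PMF.bind_toReal {S A : Type*} [Fintype A] (q : PMF A) (f : A → PMF S) (t : S) :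
    (q.bind f t).toReal = ∑ a, (q a).toReal * (f a t).toReal := by
  rw [PMF.bind_apply, tsum_fintype, ENNReal.toReal_sum fun a _ =>
    ENNReal.mul_ne_top (q.apply_ne_top a) ((f a).apply_ne_top t)]
  simp only [ENNReal.toReal_mul]

lemma PMF.toReal_pos {S : Type*} {q : PMF S} {t : S} (h : t ∈ q.support) : 0 < (q t).toReal :=
  ENNReal.toReal_pos (by rwa [PMF.mem_support_iff] at h) (q.apply_ne_top t)

lemma PMF.toReal_eq_zero {S : Type*} {q : PMF S} {t : S} (h : t ∉ q.support) :
    (q t).toReal = 0 := by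
  rw [(q.apply_eq_zero_iff t).2 h, ENNReal.toReal_zero]

/-- The pure memoryless strategy that plays the moves of `σ`. -/
noncomputable def Strategy.ofPolicy {S A : Type*} (σ : S → A) : Strategy S A :=
  fun _ h => PMF.pure (σ h.last)

namespace ConcurrentGame

section Game

variable {S A : Type*} {G : ConcurrentGame S A} {π₁ π₂ : Strategy S A}

/-- The Markov decision process obtained by fixing a move of player 2 at each state; in a player-1
MDP there is no choice. -/
noncomputable def toFinMDP (G : ConcurrentGame S A) : FinMDP S A where
  moves := G.moves₁
  moves_nonempty := G.moves₁_nonempty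
  step s a := G.δ s a (G.moves₂_nonempty s).choose

lemma next_eq_bind (hG : G.IsPlayer1MDP) (hπ₂ : π₂ ∈ G.strategies₂) {n : ℕ} (h : History S n) :
    G.next π₁ π₂ h = (π₁ n h).bind (G.toFinMDP.step h.last) := by
  have hb : π₂ n h = PMF.pure (G.moves₂_nonempty h.last).choose := by
    apply PMF.eq_pure_of_support_subset
    intro b hb
    obtain ⟨c, hc⟩ := Finset.card_eq_one.1 (hG h.last)
    have h1 := hπ₂ n h hb
    have h2 := (G.moves₂_nonempty h.last).choose_spec
    have h3 : ∀ x ∈ G.moves₂ h.last, x = c := fun x hx => by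
      rwa [hc, Finset.mem_singleton] at hx
    rw [Set.mem_singleton_iff, h3 b h1, h3 _ h2]
  unfold next
  simp only [hb, PMF.pure_bind]
  rfl

lemma ofPolicy_mem_strategies₁ {σ : S → A} (hσ : ∀ s, σ s ∈ G.moves₁ s) :
    Strategy.ofPolicy σ ∈ G.strategies₁ := fun n h => by
  simp [Strategy.ofPolicy, PMF.support_pure, hσ]

lemma strategies₁_nonempty : Nonempty G.strategies₁ := by
  choose σ hσ using G.moves₁_nonempty
  exact ⟨⟨_, ofPolicy_mem_strategies₁ hσ⟩⟩

lemma strategies₂_nonempty : Nonempty G.strategies₂ := by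
  choose σ hσ using G.moves₂_nonempty
  exact ⟨⟨Strategy.ofPolicy σ, fun n h => by simp [Strategy.ofPolicy, PMF.support_pure, hσ]⟩⟩

lemma nextProb_eq_sum [Fintype A] (hG : G.IsPlayer1MDP) (hπ₂ : π₂ ∈ G.strategies₂) (n : ℕ)
    (ω : ℕ → S) (t : S) :
    G.nextProb π₁ π₂ n ω t =
      ∑ a, (π₁ n (Preorder.frestrictLe (π := fun _ => S) n ω) a).toReal *
        (G.toFinMDP.step (ω n) a t).toReal := by
  rw [nextProb, next_eq_bind hG hπ₂, PMF.bind_toReal]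
  rfl

lemma nextProb_ofPolicy (hG : G.IsPlayer1MDP) (hπ₂ : π₂ ∈ G.strategies₂) (σ : S → A) (n : ℕ)
    (ω : ℕ → S) (t : S) :
    G.nextProb (Strategy.ofPolicy σ) π₂ n ω t = (G.toFinMDP.step (ω n) (σ (ω n)) t).toReal := by
  rw [nextProb, next_eq_bind hG hπ₂, Strategy.ofPolicy, PMF.pure_bind]
  rfl

end Game

variable {S A : Type*} [Fintype S] [MeasurableSpace S] [DiscreteMeasurableSpace S]
  {G : ConcurrentGame S A} {π₁ π₂ : Strategy S A} {p : S → ℕ}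

open scoped Classical in
lemma ae_frequently_transition_iff_not_summable (G : ConcurrentGame S A) (π₁ π₂ : Strategy S A)
    (s : S) :
    ∀ᵐ ω ∂(G.law π₁ π₂ s), ∀ x t : S, (∃ᶠ n in atTop, ω n = x ∧ ω (n + 1) = t) ↔
      ¬ Summable fun k => if ω k = x then G.nextProb π₁ π₂ k ω t else 0 := by
  filter_upwards [G.ae_frequently_transition_iff π₁ π₂ s] with ω hω x t
  rw [hω, not_summable_iff_tendsto_nat_atTop_of_nonneg]
  intro k
  split_ifs
  exacts [G.nextProb_nonneg π₁ π₂ k ω t, le_rfl]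

lemma bddBelow_measureReal (G : ConcurrentGame S A) (π₁ : Strategy S A) (s : S) :
    BddBelow (Set.range fun π₂ : G.strategies₂ => (G.law π₁ π₂ s).real (parity p)) :=
  ⟨0, by rintro _ ⟨π₂, rfl⟩; exact measureReal_nonneg⟩

/-- Playing the policy `σ`, the play respects the supports of the transition function, and all
successors of a state visited infinitely often are visited infinitely often. -/
lemma ae_ofPolicy (hG : G.IsPlayer1MDP) (hπ₂ : π₂ ∈ G.strategies₂) (σ : S → A) (s : S) :
    ∀ᵐ ω ∂(G.law (Strategy.ofPolicy σ) π₂ s),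
      (∀ n, ω (n + 1) ∈ (G.toFinMDP.step (ω n) (σ (ω n))).support) ∧
      ∀ x ∈ infStates ω, (G.toFinMDP.step x (σ x)).support ⊆ infStates ω := by
  classical
  refine Filter.Eventually.and ?_ ?_
  · rw [ae_all_iff]
    intro n
    let g : S → S → ℝ := fun x t => if t ∈ (G.toFinMDP.step x (σ x)).support then 0 else 1
    have h := G.integral_transition (Strategy.ofPolicy σ) π₂ s g n
    have hz : ∀ ω : ℕ → S,
        ∑ t, G.nextProb (Strategy.ofPolicy σ) π₂ n ω t * g (ω n) t = 0 := fun ω =>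
      Finset.sum_eq_zero fun t _ => by
        rw [nextProb_ofPolicy hG hπ₂]
        by_cases ht : t ∈ (G.toFinMDP.step (ω n) (σ (ω n))).support
        · simp only [g, ht, if_true, mul_zero]
        · rw [PMF.toReal_eq_zero ht, zero_mul]
    simp only [hz, integral_zero] at h
    rw [integral_eq_zero_iff_of_nonneg (fun ω => by simp only [g]; split_ifs <;> simp)
      (integrable_transition _ g n)] at h
    filter_upwards [h] with ω hω
    by_contra hn
    simp only [g, if_neg hn, Pi.zero_apply, one_ne_zero] at hω
  · filter_upwards [G.ae_frequently_transition_iff_not_summable (Strategy.ofPolicy σ) π₂ s]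
      with ω hω x hx t ht
    refine (mem_infStates_of_frequently_transition ((hω x t).2 fun hs => ?_)).2
    have hpos := PMF.toReal_pos ht
    obtain ⟨n, hn, hnx⟩ := (Frequently.and_eventually (show ∃ᶠ n in atTop, ω n = x from hx)
      (hs.tendsto_atTop_zero.eventually_lt_const hpos)).exists
    rw [if_pos hn, nextProb_ofPolicy hG hπ₂, hn] at hnx
    exact lt_irrefl _ hnx

variable [Fintype A]

/-- Moves which may leave the set of states visited infinitely often are played with summable
probabilities only, so that a transition taken infinitely often is due to other moves. -/
lemma ae_exists_move (hG : G.IsPlayer1MDP) (hπ₁ : π₁ ∈ G.strategies₁) (hπ₂ : π₂ ∈ G.strategies₂)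
    (s : S) :
    ∀ᵐ ω ∂(G.law π₁ π₂ s), ∀ x t, (∃ᶠ n in atTop, ω n = x ∧ ω (n + 1) = t) →
      ∃ a ∈ G.moves₁ x, (G.toFinMDP.step x a).support ⊆ infStates ω ∧
        t ∈ (G.toFinMDP.step x a).support := by
  classical
  filter_upwards [G.ae_frequently_transition_iff_not_summable π₁ π₂ s] with ω hω x t hxt
  by_contra! hc
  let w : ℕ → A → ℝ := fun k a =>
    if ω k = x then (π₁ k (Preorder.frestrictLe (π := fun _ => S) k ω) a).toReal else 0
  have hw0 : ∀ k a, 0 ≤ w k a := fun k a => by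
    simp only [w]; split_ifs
    exacts [ENNReal.toReal_nonneg, le_rfl]
  have hsum : ∀ y, (fun k => if ω k = x then G.nextProb π₁ π₂ k ω y else 0) =
      fun k => ∑ a, w k a * (G.toFinMDP.step x a y).toReal := fun y => by
    funext k
    by_cases hk : ω k = x
    · simp only [w, hk, if_true, nextProb_eq_sum hG hπ₂]
    · simp [w, hk]
  have hleave : ∀ a, ¬ ((G.toFinMDP.step x a).support ⊆ infStates ω) →
      Summable fun k => w k a := by
    intro a ha
    obtain ⟨y, hy, hyinf⟩ := Set.not_subset.1 ha
    have hs : Summable fun k => if ω k = x then G.nextProb π₁ π₂ k ω y else 0 := by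
      by_contra hns
      exact hyinf (mem_infStates_of_frequently_transition ((hω x y).2 hns)).2
    rw [hsum y] at hs
    have hpos := PMF.toReal_pos hy
    have : Summable fun k => w k a * (G.toFinMDP.step x a y).toReal :=
      hs.of_nonneg_of_le (fun k => mul_nonneg (hw0 k a) hpos.le) fun k =>
        Finset.single_le_sum (f := fun a => w k a * (G.toFinMDP.step x a y).toReal)
          (fun a _ => mul_nonneg (hw0 k a) ENNReal.toReal_nonneg) (Finset.mem_univ a)
    exact (summable_mul_right_iff hpos.ne').1 this
  refine (hω x t).1 hxt ?_
  rw [hsum t]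
  refine summable_sum fun a _ => ?_
  by_cases hsub : (G.toFinMDP.step x a).support ⊆ infStates ω
  · by_cases ha : a ∈ G.moves₁ x
    · simp [PMF.toReal_eq_zero (hc a ha hsub), summable_zero]
    · have : ∀ k, w k a = 0 := fun k => by
        by_cases hk : ω k = x
        · simp only [w, hk, if_true]
          refine PMF.toReal_eq_zero fun h => ha ?_
          have := hπ₁ k _ h
          rwa [show History.last (Preorder.frestrictLe (π := fun _ => S) k ω) = x from hk] at this
        · simp [w, hk]
      simp [this, summable_zero]
  · exact (hleave a hsub).mul_right _

lemma ae_infStates_subset_winSet (hG : G.IsPlayer1MDP) (hπ₁ : π₁ ∈ G.strategies₁)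
    (hπ₂ : π₂ ∈ G.strategies₂) (p : S → ℕ) (s : S) :
    ∀ᵐ ω ∂(G.law π₁ π₂ s), ω ∈ parity p → infStates ω ⊆ G.toFinMDP.winSet p := by
  filter_upwards [ae_exists_move hG hπ₁ hπ₂ s] with ω hω
  exact FinMDP.infStates_subset_winSet hω

/-- A superharmonic function decreases in expectation along any play. -/
lemma integral_superharmonic_le (hG : G.IsPlayer1MDP) (hπ₁ : π₁ ∈ G.strategies₁)
    (hπ₂ : π₂ ∈ G.strategies₂) {v : S → ℝ}
    (hv : ∀ s, ∀ a ∈ G.moves₁ s, G.toFinMDP.expect v s a ≤ v s) (s : S) (n : ℕ) :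
    ∫ ω, v (ω n) ∂(G.law π₁ π₂ s) ≤ v s := by
  induction n with
  | zero =>
    have : ∫ ω, v (ω 0) ∂(G.law π₁ π₂ s) = ∫ _, v s ∂(G.law π₁ π₂ s) :=
      integral_congr_ae ((G.ae_zero_eq π₁ π₂ s).mono fun ω hω => by simp only [hω])
    rw [this, integral_const, probReal_univ, one_smul]
  | succ n ih =>
    rw [G.integral_transition π₁ π₂ s (fun _ t => v t) n]
    refine (integral_mono (G.integrable_sum_nextProb π₁ π₂ s (fun _ t => v t) n)
      (integrable_transition _ (fun x _ => v x) n) fun ω => ?_).trans ih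
    change ∑ t, G.nextProb π₁ π₂ n ω t * v t ≤ v (ω n)
    let w : A → ℝ := fun a => (π₁ n (Preorder.frestrictLe (π := fun _ => S) n ω) a).toReal
    calc ∑ t, G.nextProb π₁ π₂ n ω t * v t
        = ∑ a, w a * G.toFinMDP.expect v (ω n) a := by
          simp only [nextProb_eq_sum hG hπ₂, Finset.sum_mul, FinMDP.expect, Finset.mul_sum, w]
          rw [Finset.sum_comm]
          simp only [mul_assoc]
      _ ≤ ∑ a, w a * v (ω n) := Finset.sum_le_sum fun a _ => by
          by_cases ha : a ∈ G.moves₁ (ω n)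
          · exact mul_le_mul_of_nonneg_left (hv _ a ha) ENNReal.toReal_nonneg
          · have : w a = 0 := PMF.toReal_eq_zero fun h => ha (hπ₁ n _ h)
            simp [this]
      _ = v (ω n) := by rw [← Finset.sum_mul, PMF.sum_toReal_eq_one, one_mul]

/-- No strategy meets the parity objective with a probability above the reachability value of the
winning set: almost surely on the objective the play ends up in the winning set, where the
reachability value is `1`. -/
lemma measureReal_parity_le_reachVal (hG : G.IsPlayer1MDP) (hπ₁ : π₁ ∈ G.strategies₁)
    (hπ₂ : π₂ ∈ G.strategies₂) (p : S → ℕ) (s : S) :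
    (G.law π₁ π₂ s).real (parity p) ≤ G.toFinMDP.reachVal (G.toFinMDP.winSet p) s := by
  set v := G.toFinMDP.reachVal (G.toFinMDP.winSet p) with hv
  have hmeas : ∀ n, Measurable fun ω : ℕ → S => v (ω n) := fun n =>
    (measurable_of_countable v).comp (measurable_pi_apply n)
  have hbd : ∀ n (ω : ℕ → S), (parity p).indicator (fun ω => v (ω n)) ω ≤ v (ω n) :=
    fun n ω => Set.indicator_le_self' (fun _ _ => FinMDP.reachVal_nonneg _) ω
  have h0 : ∀ n (ω : ℕ → S), 0 ≤ (parity p).indicator (fun ω => v (ω n)) ω :=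
    fun n ω => Set.indicator_nonneg (fun _ _ => FinMDP.reachVal_nonneg _) ω
  have hlim : Tendsto (fun n => ∫ ω, (parity p).indicator (fun ω => v (ω n)) ω ∂(G.law π₁ π₂ s))
      atTop (nhds (∫ ω, (parity p).indicator 1 ω ∂(G.law π₁ π₂ s))) := by
    refine tendsto_integral_of_dominated_convergence (fun _ => 1)
      (fun n => ((hmeas n).indicator (measurableSet_parity p)).aestronglyMeasurable)
      (integrable_const 1) (fun n => Eventually.of_forall fun ω => ?_) ?_
    · rw [Real.norm_of_nonneg (h0 n ω)]
      exact (hbd n ω).trans (FinMDP.reachVal_le_one _)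
    · filter_upwards [ae_infStates_subset_winSet hG hπ₁ hπ₂ p s] with ω hω
      by_cases hp : ω ∈ parity p
      · refine tendsto_const_nhds.congr' ?_
        filter_upwards [eventually_mem_infStates ω] with n hn
        simp only [Set.indicator_of_mem hp, Pi.one_apply]
        exact (FinMDP.reachVal_eq_one (hω hp hn)).symm
      · simp [Set.indicator_of_notMem hp]
  rw [integral_indicator_one (measurableSet_parity p)] at hlim
  refine le_of_tendsto' hlim fun n => ?_
  refine (integral_mono_of_nonneg (Eventually.of_forall (h0 n))
    (integrable_transition _ (fun x _ => v x) n) (Eventually.of_forall (hbd n))).trans ?_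
  exact integral_superharmonic_le hG hπ₁ hπ₂ (fun s a ha => FinMDP.expect_reachVal_le s ha) s n

/-- Some strategy meets the parity objective with at least the discounted reachability value: it is
greedy until it reaches the winning set, and then wins almost surely. -/
lemma exists_strategy_discVal_le (hG : G.IsPlayer1MDP) (p : S → ℕ) (k : ℕ) :
    ∃ π₁ ∈ G.strategies₁, ∀ π₂ ∈ G.strategies₂, ∀ s,
      G.toFinMDP.discVal (G.toFinMDP.winSet p) k s ≤ (G.law π₁ π₂ s).real (parity p) := by
  classical
  set W := G.toFinMDP.winSet p with hW
  set v := G.toFinMDP.discVal W k with hv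
  set γ := FinMDP.discount k
  have hγ0 : 0 ≤ γ := FinMDP.discount_nonneg k
  have hγ1 : γ < 1 := FinMDP.discount_lt_one k
  obtain ⟨σg, hσg, hsol⟩ := (G.toFinMDP.isDiscValue_discVal W k).exists_policy
  obtain ⟨σw, hσw, hwin⟩ := G.toFinMDP.exists_winning_policy p
  let σ : S → A := fun s => if s ∈ W then σw s else σg s
  have hσW : ∀ s ∈ W, σ s = σw s := fun s hs => if_pos hs
  have hσW' : ∀ s ∉ W, σ s = σg s := fun s hs => if_neg hs
  have hσ : ∀ s, σ s ∈ G.moves₁ s := fun s => by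
    by_cases hs : s ∈ W
    · rw [hσW s hs]; exact (hσw s hs).1
    · rw [hσW' s hs]; exact hσg s
  refine ⟨Strategy.ofPolicy σ, ofPolicy_mem_strategies₁ hσ, fun π₂ hπ₂ s => ?_⟩
  let μ := G.law (Strategy.ofPolicy σ) π₂ s
  have hreach : ∀ n, μ.real {ω | ω n ∈ W} ≤ μ.real (parity p) := fun n => by
    refine ENNReal.toReal_mono (measure_ne_top _ _) (measure_mono_ae ?_)
    filter_upwards [ae_ofPolicy hG hπ₂ σ s] with ω hω hn
    refine hwin ω ⟨n, hn⟩ (fun j hj => ?_) fun x hx hxW => ?_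
    · rw [← hσW _ hj]; exact hω.1 j
    · rw [← hσW x hxW]; exact hω.2 x hx
  -- along the play `g n (ω n)` increases in expectation from `v s`, while it exceeds the indicator
  -- of `ω n ∈ W` by at most `γ ^ n`
  let g : ℕ → S → ℝ := fun n x => if x ∈ W then 1 else γ ^ n * v x
  have hgstep : ∀ n x, g n x ≤ G.toFinMDP.expect (g (n + 1)) x (σ x) := by
    intro n x
    by_cases hx : x ∈ W
    · have : G.toFinMDP.expect (g (n + 1)) x (σ x) = G.toFinMDP.expect (fun _ => 1) x (σ x) :=
        Finset.sum_congr rfl fun t _ => by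
          by_cases ht : t ∈ (G.toFinMDP.step x (σ x)).support
          · have htW : t ∈ W := (hσw x hx).2 (by rwa [← hσW x hx])
            simp only [g, htW, if_true]
          · rw [PMF.toReal_eq_zero ht, zero_mul, zero_mul]
      rw [this, FinMDP.expect_const]
      simp only [g, hx, if_true, le_refl]
    · have h1 : v x = γ * G.toFinMDP.expect v x (σg x) := by
        rw [← FinMDP.sum_discMatrix_mul]; exact hsol.2 x hx
      have h2 : γ ^ (n + 1) * G.toFinMDP.expect v x (σg x) =
          G.toFinMDP.expect (fun t => γ ^ (n + 1) * v t) x (σg x) := by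
        simp only [FinMDP.expect, Finset.mul_sum]
        exact Finset.sum_congr rfl fun t _ => by ring
      simp only [hσW' x hx]
      calc g n x = γ ^ (n + 1) * G.toFinMDP.expect v x (σg x) := by
            simp only [g, hx, if_false]; rw [h1]; ring
        _ ≤ _ := by
            rw [h2]
            refine FinMDP.expect_mono (fun t => ?_) x _
            by_cases ht : t ∈ W
            · simp only [g, ht, if_true]
              exact mul_le_one₀ (pow_le_one₀ hγ0 hγ1.le) (FinMDP.discVal_nonneg k t)
                (FinMDP.discVal_le_one k t)
            · simp only [g, ht, if_false, le_refl]
  have hint : ∀ n, Integrable (fun ω : ℕ → S => g n (ω n)) μ := fun n =>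
    integrable_transition _ (fun x _ => g n x) n
  have hle : ∀ n, v s ≤ ∫ ω, g n (ω n) ∂μ := by
    intro n
    induction n with
    | zero =>
      have h1 : ∫ ω, g 0 (ω 0) ∂μ = ∫ _, g 0 s ∂μ :=
        integral_congr_ae ((G.ae_zero_eq _ π₂ s).mono fun ω hω => by simp only [hω])
      rw [h1, integral_const, probReal_univ, one_smul]
      by_cases hs : s ∈ W
      · simp only [g, hs, if_true]; exact FinMDP.discVal_le_one k s
      · simp only [g, hs, if_false, pow_zero, one_mul, le_refl]
    | succ n ih =>
      refine ih.trans ?_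
      have h1 := G.integral_transition (Strategy.ofPolicy σ) π₂ s (fun _ t => g (n + 1) t) n
      rw [show ∫ ω, g (n + 1) (ω (n + 1)) ∂μ = _ from h1]
      refine integral_mono (hint n) (G.integrable_sum_nextProb _ π₂ s (fun _ t => g (n + 1) t) n)
        fun ω => ?_
      simp only [nextProb_ofPolicy hG hπ₂]
      exact hgstep n (ω n)
  have hWm : ∀ n, MeasurableSet {ω : ℕ → S | ω n ∈ W} := fun n =>
    (measurable_pi_apply n) (MeasurableSet.of_discrete (s := W))
  have hbound : ∀ n, v s ≤ μ.real (parity p) + γ ^ n := fun n => by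
    refine (hle n).trans ?_
    have h1 : ∫ ω, g n (ω n) ∂μ ≤ ∫ ω, ({ω : ℕ → S | ω n ∈ W}.indicator 1 ω + γ ^ n) ∂μ := by
      refine integral_mono (hint n) (((integrable_const (1 : ℝ)).indicator (hWm n)).add
        (integrable_const _)) fun ω => ?_
      by_cases hω : ω n ∈ W
      · simp only [g, hω, if_true, Set.indicator, Set.mem_ofPred_eq, Pi.one_apply]
        linarith [pow_nonneg hγ0 n]
      · simp only [g, hω, if_false, Set.indicator, Set.mem_ofPred_eq, zero_add]
        exact mul_le_of_le_one_right (pow_nonneg hγ0 n) (FinMDP.discVal_le_one k _)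
    rw [integral_add (f := {ω : ℕ → S | ω n ∈ W}.indicator 1)
      ((integrable_const (1 : ℝ)).indicator (hWm n)) (integrable_const _), integral_indicator_one (hWm n),
      integral_const, probReal_univ, one_smul] at h1
    linarith [hreach n]
  have hlim : Tendsto (fun n => μ.real (parity p) + γ ^ n) atTop (nhds (μ.real (parity p) + 0)) :=
    (tendsto_pow_atTop_nhds_zero_of_lt_one hγ0 hγ1).const_add _
  rw [add_zero] at hlim
  exact ge_of_tendsto' hlim hbound

lemma valOf_parityObj_le_reachVal (hG : G.IsPlayer1MDP) (hπ₁ : π₁ ∈ G.strategies₁) (s : S) :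
    G.valOf (parityObj p) π₁ s ≤ G.toFinMDP.reachVal (G.toFinMDP.winSet p) s := by
  obtain ⟨π₂⟩ := G.strategies₂_nonempty
  simp only [valOf, integral_parityObj]
  exact (ciInf_le (bddBelow_measureReal G π₁ s) π₂).trans
    (measureReal_parity_le_reachVal hG hπ₁ π₂.2 p s)

/-- The value of a parity objective is the value of reaching the winning set. -/
theorem val_parityObj_eq_reachVal (hG : G.IsPlayer1MDP) (p : S → ℕ) (s : S) :
    G.val (parityObj p) s = G.toFinMDP.reachVal (G.toFinMDP.winSet p) s := by
  have := G.strategies₁_nonempty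
  have := G.strategies₂_nonempty
  refine le_antisymm (ciSup_le fun π₁ => valOf_parityObj_le_reachVal hG π₁.2 s) ?_
  refine ciSup_le fun k => ?_
  obtain ⟨π₁, hπ₁, h⟩ := exists_strategy_discVal_le hG p k
  refine le_trans ?_ (le_ciSup (f := fun π₁ : G.strategies₁ => G.valOf (parityObj p) π₁ s)
    ⟨1, ?_⟩ ⟨π₁, hπ₁⟩)
  · simp only [valOf, integral_parityObj]
    exact le_ciInf fun π₂ => h π₂ π₂.2 s
  · rintro _ ⟨π, rfl⟩
    exact (valOf_parityObj_le_reachVal hG π.2 s).trans (FinMDP.reachVal_le_one s)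

end ConcurrentGame

/-! ### Perturbation of the transition probabilities -/

/-- As `(1 + x) ^ (2 * n) ≤ 2` forces `n * x ≤ 1 / 2`, the surplus factor `(1 + x) ^ 2` makes up for
the loss `(1 - x ^ 2) ^ (n - 1) ≥ 1 - x / 2`. -/
lemma div_pow_le_one_add_pow {x : ℝ} (hx0 : 0 ≤ x) {n : ℕ} (hn : 1 ≤ n)
    (h : (1 + x) ^ (2 * n) ≤ 2) : x < 1 ∧ ((1 + x) / (1 - x)) ^ (n - 1) ≤ (1 + x) ^ (2 * n) := by
  obtain ⟨m, rfl⟩ : ∃ m, n = m + 1 := ⟨n - 1, by omega⟩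
  have hB := one_add_mul_le_pow (a := x) (by linarith) (2 * (m + 1))
  push_cast at hB
  have hm0 : (0 : ℝ) ≤ m := Nat.cast_nonneg m
  have hx2 : x ≤ 1 / 2 := by nlinarith [mul_nonneg hm0 hx0]
  have hmx : m * x ≤ 1 / 2 := by nlinarith
  refine ⟨by linarith, ?_⟩
  have hpos : 0 < (1 - x) ^ m := pow_pos (by linarith) m
  rw [Nat.add_sub_cancel, div_pow, div_le_iff₀ hpos]
  have hB2 := one_add_mul_le_pow (a := -x ^ 2) (by nlinarith) m
  have h1 : 1 - x / 2 ≤ (1 + -x ^ 2) ^ m := by nlinarith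
  have h2 : 1 ≤ (1 + -x ^ 2) ^ m * (1 + x) ^ 2 := by
    have : (1 - x / 2) * (1 + x) ^ 2 ≤ (1 + -x ^ 2) ^ m * (1 + x) ^ 2 :=
      mul_le_mul_of_nonneg_right h1 (sq_nonneg _)
    nlinarith [mul_nonneg hx0 hx0, mul_nonneg hx0 (mul_nonneg hx0 hx0)]
  have h3 : (1 + x) ^ (2 * (m + 1)) * (1 - x) ^ m =
      (1 + x) ^ m * ((1 + -x ^ 2) ^ m * (1 + x) ^ 2) := by
    rw [show 1 + -x ^ 2 = (1 + x) * (1 - x) by ring, mul_pow]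
    ring
  rw [h3]
  exact le_mul_of_one_le_right (by positivity) h2

lemma abs_sub_le_of_le_mul {u v K : ℝ} (hu1 : u ≤ 1) (hv1 : v ≤ 1) (hK : 1 ≤ K)
    (huv : u ≤ K * v) (hvu : v ≤ K * u) : |u - v| ≤ K - 1 := by
  rw [abs_le]
  constructor <;> nlinarith

namespace ConcurrentGame

variable {S A : Type*} {G₁ G₂ : ConcurrentGame S A}

lemma StructEquiv.symm (h : G₁.StructEquiv G₂) : G₂.StructEquiv G₁ :=
  ⟨h.1.symm, h.2.1.symm, fun s a ha b hb => (h.2.2 s a (h.1 ▸ ha) b (h.2.1 ▸ hb)).symm⟩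

lemma StructEquiv.isPlayer1MDP (h : G₁.StructEquiv G₂) (hG : G₁.IsPlayer1MDP) :
    G₂.IsPlayer1MDP := fun s => by rw [← h.2.1]; exact hG s

/-- Fixing a move of player 2 picks the same move in two games with the same moves of player 2. -/
lemma toFinMDP_step_of_moves₂_eq (h : G₁.moves₂ = G₂.moves₂) (s : S) :
    ∃ b ∈ G₁.moves₂ s, ∀ a, G₁.toFinMDP.step s a = G₁.δ s a b ∧
      G₂.toFinMDP.step s a = G₂.δ s a b := by
  have key : ∀ (m₁ m₂ : S → Finset A) (_ : m₁ = m₂) (h₁ : ∀ s, (m₁ s).Nonempty)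
      (h₂ : ∀ s, (m₂ s).Nonempty), (h₁ s).choose = (h₂ s).choose := by
    rintro m₁ _ rfl _ _; rfl
  refine ⟨_, (G₁.moves₂_nonempty s).choose_spec, fun a => ⟨rfl, ?_⟩⟩
  rw [key _ _ h G₁.moves₂_nonempty G₂.moves₂_nonempty]
  rfl

lemma StructEquiv.winSet_eq (h : G₁.StructEquiv G₂) (p : S → ℕ) :
    G₁.toFinMDP.winSet p = G₂.toFinMDP.winSet p := by
  have key : ∀ {G₁ G₂ : ConcurrentGame S A}, G₁.StructEquiv G₂ →
      G₁.toFinMDP.winSet p ⊆ G₂.toFinMDP.winSet p := fun {G₁ G₂} h =>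
    FinMDP.winSet_subset_of_support_eq h.1 (fun s a ha => by
      obtain ⟨b, hb, hstep⟩ := toFinMDP_step_of_moves₂_eq h.2.1 s
      rw [(hstep a).1, (hstep a).2]
      exact h.2.2 s a ha b hb) p
  exact (key h).antisymm (key h.symm)

lemma prob_pos_iff (G : ConcurrentGame S A) (s : S) (a b : A) (t : S) :
    0 < G.prob s a b t ↔ t ∈ (G.δ s a b).support := by
  refine ⟨fun h => ?_, PMF.toReal_pos⟩
  by_contra hn
  rw [prob, PMF.toReal_eq_zero hn] at h
  exact lt_irrefl _ h

section Val

variable [Fintype S] [MeasurableSpace S] [DiscreteMeasurableSpace S] [Fintype A]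

/-- Both values are reachability values of the same set, which depends on the supports only. -/
lemma StructEquiv.val_le_pow_mul (h : G₁.StructEquiv G₂) (hG : G₁.IsPlayer1MDP) {a b : ℝ}
    (ha : 0 < a) (ha1 : a ≤ 1) (hb1 : 1 ≤ b)
    (hlo : ∀ s, ∀ x ∈ G₁.moves₁ s, ∀ y ∈ G₁.moves₂ s, ∀ t,
      a * G₁.prob s x y t ≤ G₂.prob s x y t)
    (hhi : ∀ s, ∀ x ∈ G₁.moves₁ s, ∀ y ∈ G₁.moves₂ s, ∀ t,
      G₂.prob s x y t ≤ b * G₁.prob s x y t) (p : S → ℕ) (s : S) :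
    G₂.val (parityObj p) s ≤ (b / a) ^ (Fintype.card S - 1) * G₁.val (parityObj p) s := by
  rw [val_parityObj_eq_reachVal hG, val_parityObj_eq_reachVal (h.isPlayer1MDP hG), ← h.winSet_eq]
  refine FinMDP.reachVal_le_pow_mul h.1 ha ha1 hb1 (fun s x hx t => ?_) (fun s x hx t => ?_) s
  all_goals
    obtain ⟨y, hy, hstep⟩ := toFinMDP_step_of_moves₂_eq h.2.1 s
    rw [(hstep x).1, (hstep x).2]
  exacts [hlo s x hx y hy t, hhi s x hx y hy t]

lemma IsPlayer1MDP.val_parityObj_mem_Icc (hG : G₁.IsPlayer1MDP) (p : S → ℕ) (s : S) :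
    0 ≤ G₁.val (parityObj p) s ∧ G₁.val (parityObj p) s ≤ 1 := by
  rw [val_parityObj_eq_reachVal hG]
  exact ⟨FinMDP.reachVal_nonneg s, FinMDP.reachVal_le_one s⟩

lemma StructEquiv.abs_val_sub_le (h : G₁.StructEquiv G₂) (hG : G₁.IsPlayer1MDP) {a b : ℝ}
    (ha : 0 < a) (ha1 : a ≤ 1) (hb1 : 1 ≤ b)
    (hlo : ∀ s, ∀ x ∈ G₁.moves₁ s, ∀ y ∈ G₁.moves₂ s, ∀ t,
      a * G₁.prob s x y t ≤ G₂.prob s x y t)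
    (hhi : ∀ s, ∀ x ∈ G₁.moves₁ s, ∀ y ∈ G₁.moves₂ s, ∀ t,
      G₂.prob s x y t ≤ b * G₁.prob s x y t) (p : S → ℕ) (s : S) :
    |G₁.val (parityObj p) s - G₂.val (parityObj p) s| ≤ (b / a) ^ (Fintype.card S - 1) - 1 := by
  have hG₂ := h.isPlayer1MDP hG
  have hb : 0 < b := by linarith
  have h1 := h.val_le_pow_mul hG ha ha1 hb1 hlo hhi p s
  have h2 := h.symm.val_le_pow_mul hG₂ (a := 1 / b) (b := 1 / a) (by positivity)
    (by rw [div_le_one hb]; exact hb1) (by rw [le_div_iff₀ ha]; linarith)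
    (fun s x hx y hy t => by
      rw [one_div_mul_eq_div, div_le_iff₀' hb]
      exact hhi s x (h.1 ▸ hx) y (h.2.1 ▸ hy) t)
    (fun s x hx y hy t => by
      rw [one_div_mul_eq_div, le_div_iff₀' ha]
      exact hlo s x (h.1 ▸ hx) y (h.2.1 ▸ hy) t) p s
  rw [show 1 / a / (1 / b) = b / a by field_simp] at h2
  exact abs_sub_le_of_le_mul (hG.val_parityObj_mem_Icc p s).2 (hG₂.val_parityObj_mem_Icc p s).2
    (one_le_pow₀ (by rw [le_div_iff₀ ha]; linarith)) h2 h1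

/-- If the transition probabilities have relative error at most `x` with respect to `G₁`, then the
ratio of the values is at most `((1 + x) / (1 - x)) ^ (|S| - 1)`, and this suffices: no lower bound
for the transition probabilities of `G₂` is involved. -/
lemma StructEquiv.abs_val_sub_le_of_relative [Nonempty S] (h : G₁.StructEquiv G₂)
    (hG : G₁.IsPlayer1MDP) {x : ℝ} (hx : 0 ≤ x)
    (hclose : ∀ s, ∀ a ∈ G₁.moves₁ s, ∀ b ∈ G₁.moves₂ s, ∀ t,
      |G₁.prob s a b t - G₂.prob s a b t| ≤ x * G₁.prob s a b t) (p : S → ℕ) (s : S) :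
    |G₁.val (parityObj p) s - G₂.val (parityObj p) s| ≤ (1 + x) ^ (2 * Fintype.card S) - 1 := by
  obtain ⟨h3, h4⟩ := hG.val_parityObj_mem_Icc p s
  obtain ⟨h5, h6⟩ := (h.isPlayer1MDP hG).val_parityObj_mem_Icc p s
  -- the bound is trivial if it exceeds `1`, and this includes the case `1 ≤ x`
  by_cases h2 : (1 + x) ^ (2 * Fintype.card S) ≤ 2
  · obtain ⟨hx1, hle⟩ := div_pow_le_one_add_pow hx Fintype.card_pos h2
    refine (h.abs_val_sub_le hG (a := 1 - x) (b := 1 + x) (by linarith) (by linarith)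
      (by linarith) (fun s a ha b hb t => ?_) (fun s a ha b hb t => ?_) p s).trans (by linarith)
    all_goals
      have := abs_le.1 (hclose s a ha b hb t)
      linarith
  · rw [abs_le]
    constructor <;> linarith

end Val

section Dist

lemma bddAbove_distA [Finite S] [Finite A] (G₁ G₂ : ConcurrentGame S A) :
    BddAbove {x | ∃ s, ∃ a ∈ G₁.moves₁ s, ∃ b ∈ G₁.moves₂ s, ∃ t,
      x = |G₁.prob s a b t - G₂.prob s a b t|} := by
  refine ((Set.finite_range fun q : S × A × A × S =>
    |G₁.prob q.1 q.2.1 q.2.2.1 q.2.2.2 - G₂.prob q.1 q.2.1 q.2.2.1 q.2.2.2|).subset ?_).bddAbove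
  rintro _ ⟨s, a, -, b, -, t, rfl⟩
  exact ⟨(s, a, b, t), rfl⟩

lemma abs_prob_sub_le_distA [Finite S] [Finite A] {s : S} {a b : A} (ha : a ∈ G₁.moves₁ s)
    (hb : b ∈ G₁.moves₂ s) (t : S) : |G₁.prob s a b t - G₂.prob s a b t| ≤ G₁.distA G₂ :=
  le_csSup (bddAbove_distA G₁ G₂) ⟨s, a, ha, b, hb, t, rfl⟩

lemma distA_nonneg (G₁ G₂ : ConcurrentGame S A) : 0 ≤ G₁.distA G₂ :=
  Real.sSup_nonneg (by rintro _ ⟨_, _, _, _, _, _, rfl⟩; exact abs_nonneg _)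

lemma StructEquiv.abs_prob_sub_le_mul [Finite S] [Finite A] (h : G₁.StructEquiv G₂) {η : ℝ}
    (hη : IsLeast G₁.posProbs η) {s : S} {a b : A} (ha : a ∈ G₁.moves₁ s) (hb : b ∈ G₁.moves₂ s)
    (t : S) : |G₁.prob s a b t - G₂.prob s a b t| ≤ G₁.distA G₂ / η * G₁.prob s a b t := by
  obtain ⟨_, _, _, _, _, _, _, hη0⟩ := hη.1
  by_cases ht : t ∈ (G₁.δ s a b).support
  · have hle : η ≤ G₁.prob s a b t :=
      hη.2 ⟨s, a, ha, b, hb, t, rfl, (G₁.prob_pos_iff s a b t).2 ht⟩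
    refine (abs_prob_sub_le_distA ha hb t).trans ?_
    rw [div_mul_eq_mul_div, le_div_iff₀ hη0]
    exact mul_le_mul_of_nonneg_left hle (distA_nonneg _ _)
  · have ht₂ := ht
    rw [h.2.2 s a ha b hb] at ht₂
    simp [prob, PMF.toReal_eq_zero ht, PMF.toReal_eq_zero ht₂]

lemma bddAbove_distR [Finite S] [Finite A] (G₁ G₂ : ConcurrentGame S A) :
    BddAbove {x | ∃ s, ∃ a ∈ G₁.moves₁ s, ∃ b ∈ G₁.moves₂ s, ∃ t ∈ (G₁.δ s a b).support,
      x = G₁.prob s a b t / G₂.prob s a b t ∨ x = G₂.prob s a b t / G₁.prob s a b t} := by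
  refine (((Set.finite_range fun q : S × A × A × S =>
    G₁.prob q.1 q.2.1 q.2.2.1 q.2.2.2 / G₂.prob q.1 q.2.1 q.2.2.1 q.2.2.2).union
    (Set.finite_range fun q : S × A × A × S =>
    G₂.prob q.1 q.2.1 q.2.2.1 q.2.2.2 / G₁.prob q.1 q.2.1 q.2.2.1 q.2.2.2)).subset ?_).bddAbove
  rintro _ ⟨s, a, -, b, -, t, -, rfl | rfl⟩
  exacts [Or.inl ⟨(s, a, b, t), rfl⟩, Or.inr ⟨(s, a, b, t), rfl⟩]

lemma StructEquiv.prob_le_distR_mul [Finite S] [Finite A] (h : G₁.StructEquiv G₂) {s : S}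
    {a b : A} (ha : a ∈ G₁.moves₁ s) (hb : b ∈ G₁.moves₂ s) (t : S) :
    G₁.prob s a b t ≤ (1 + G₁.distR G₂) * G₂.prob s a b t ∧
      G₂.prob s a b t ≤ (1 + G₁.distR G₂) * G₁.prob s a b t := by
  by_cases ht : t ∈ (G₁.δ s a b).support
  · have ht₂ := ht
    rw [h.2.2 s a ha b hb] at ht₂
    rw [distR, add_sub_cancel, ← div_le_iff₀ ((G₁.prob_pos_iff s a b t).2 ht),
      ← div_le_iff₀ ((G₂.prob_pos_iff s a b t).2 ht₂)]
    exact ⟨le_csSup (bddAbove_distR G₁ G₂) ⟨s, a, ha, b, hb, t, ht, Or.inl rfl⟩,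
      le_csSup (bddAbove_distR G₁ G₂) ⟨s, a, ha, b, hb, t, ht, Or.inr rfl⟩⟩
  · have ht₂ := ht
    rw [h.2.2 s a ha b hb] at ht₂
    simp [prob, PMF.toReal_eq_zero ht, PMF.toReal_eq_zero ht₂]

/-- Some ratio of corresponding probabilities or its inverse is at least `1`. -/
lemma StructEquiv.distR_nonneg [Finite S] [Finite A] [Nonempty S] (h : G₁.StructEquiv G₂) :
    0 ≤ G₁.distR G₂ := by
  obtain ⟨s⟩ := ‹Nonempty S›
  obtain ⟨a, ha⟩ := G₁.moves₁_nonempty s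
  obtain ⟨b, hb⟩ := G₁.moves₂_nonempty s
  obtain ⟨t, ht⟩ := (G₁.δ s a b).support_nonempty
  have h1 := (G₁.prob_pos_iff s a b t).2 ht
  have h2 := (G₂.prob_pos_iff s a b t).2 (h.2.2 s a ha b hb ▸ ht)
  obtain ⟨h3, h4⟩ := h.prob_le_distR_mul ha hb t
  by_contra! hneg
  rcases le_total (G₁.prob s a b t) (G₂.prob s a b t) with hle | hle <;> nlinarith

lemma StructEquiv.distR_le [Finite S] [Finite A] [Nonempty S] (h : G₁.StructEquiv G₂) {η : ℝ}
    (hη : IsLeast (G₁.posProbs ∪ G₂.posProbs) η) : G₁.distR G₂ ≤ G₁.distA G₂ / η := by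
  have hη0 : 0 < η := by
    rcases hη.1 with ⟨_, _, _, _, _, _, _, h⟩ | ⟨_, _, _, _, _, _, _, h⟩ <;> exact h
  have hd := distA_nonneg G₁ G₂
  have key : ∀ u v : ℝ, η ≤ v → |u - v| ≤ G₁.distA G₂ → u / v ≤ 1 + G₁.distA G₂ / η := by
    intro u v hv huv
    have hv0 : 0 < v := hη0.trans_le hv
    rw [div_le_iff₀ hv0]
    have h1 : G₁.distA G₂ ≤ G₁.distA G₂ / η * v := by
      rw [div_mul_eq_mul_div, le_div_iff₀ hη0]
      exact mul_le_mul_of_nonneg_left hv hd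
    linarith [le_abs_self (u - v)]
  rw [distR, sub_le_iff_le_add']
  refine csSup_le ?_ ?_
  · obtain ⟨s⟩ := ‹Nonempty S›
    obtain ⟨a, ha⟩ := G₁.moves₁_nonempty s
    obtain ⟨b, hb⟩ := G₁.moves₂_nonempty s
    obtain ⟨t, ht⟩ := (G₁.δ s a b).support_nonempty
    exact ⟨_, s, a, ha, b, hb, t, ht, Or.inl rfl⟩
  · rintro x ⟨s, a, ha, b, hb, t, ht, hx⟩
    have habs := abs_prob_sub_le_distA (G₂ := G₂) ha hb t
    have h1 : η ≤ G₁.prob s a b t :=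
      hη.2 (Or.inl ⟨s, a, ha, b, hb, t, rfl, (G₁.prob_pos_iff s a b t).2 ht⟩)
    have h2 : η ≤ G₂.prob s a b t :=
      hη.2 (Or.inr ⟨s, a, h.1 ▸ ha, b, h.2.1 ▸ hb, t, rfl,
        (G₂.prob_pos_iff s a b t).2 (h.2.2 s a ha b hb ▸ ht)⟩)
    rcases hx with rfl | rfl
    · exact key _ _ h2 habs
    · exact key _ _ h1 (by rwa [abs_sub_comm])

end Dist

section Restrict

/-- The game in which player 1 is bound to follow the policy `σ`. -/
def restrict (G : ConcurrentGame S A) (σ : S → A) : ConcurrentGame S A where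
  moves₁ s := {σ s}
  moves₂ := G.moves₂
  moves₁_nonempty _ := Finset.singleton_nonempty _
  moves₂_nonempty := G.moves₂_nonempty
  δ := G.δ

lemma val_restrict [Fintype S] [MeasurableSpace S] [DiscreteMeasurableSpace S]
    (G : ConcurrentGame S A) (σ : S → A) (Φ : (ℕ → S) → ℝ) (s : S) :
    (G.restrict σ).val Φ s = G.valOf Φ (Strategy.ofPolicy σ) s := by
  have hmem : Strategy.ofPolicy σ ∈ (G.restrict σ).strategies₁ :=
    ofPolicy_mem_strategies₁ fun s => Finset.mem_singleton_self _
  have hall : ∀ π : (G.restrict σ).strategies₁, (π : Strategy S A) = Strategy.ofPolicy σ := by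
    rintro ⟨π, hπ⟩
    funext n h
    exact PMF.eq_pure_of_support_subset (by simpa [restrict] using hπ n h)
  have : Nonempty (G.restrict σ).strategies₁ := ⟨⟨_, hmem⟩⟩
  unfold val
  simp only [hall, ciSup_const]
  rfl

lemma _root_.Strategy.eq_ofPolicy_of_isPure {π : Strategy S A} (h₁ : π.IsPure)
    (h₂ : π.IsMemoryless) : ∃ σ : S → A, π = Strategy.ofPolicy σ := by
  choose σ hσ using fun s : S => h₁ 0 fun _ => s
  refine ⟨σ, funext fun n => funext fun h => ?_⟩
  rw [h₂ n h]
  exact PMF.eq_pure_of_support_subset ((PMF.apply_eq_one_iff _ _).1 (hσ h.last)).subset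

end Restrict

end ConcurrentGame

theorem mainTheorem5 {S A : Type*} [Fintype S] [Nonempty S] [MeasurableSpace S]
    [DiscreteMeasurableSpace S] [Fintype A]
    (G₁ : ConcurrentGame S A) (hG₁ : G₁.IsPlayer1MDP)
    (η : ℝ) (hη : IsLeast G₁.posProbs η) :
    (∀ G₂ : ConcurrentGame S A, G₂.IsPlayer1MDP → G₁.StructEquiv G₂ →
      (∀ (p : S → ℕ) (s : S),
        |G₁.val (ConcurrentGame.parityObj p) s - G₂.val (ConcurrentGame.parityObj p) s|
            ≤ (1 + G₁.distR G₂) ^ (2 * Fintype.card S) - 1 ∧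
        |G₁.val (ConcurrentGame.parityObj p) s - G₂.val (ConcurrentGame.parityObj p) s|
            ≤ (1 + G₁.distA G₂ / η) ^ (2 * Fintype.card S) - 1) ∧
      (∀ η' : ℝ, IsLeast (G₁.posProbs ∪ G₂.posProbs) η' →
        (1 + G₁.distR G₂) ^ (2 * Fintype.card S) - 1
            ≤ (1 + G₁.distA G₂ / η') ^ (2 * Fintype.card S) - 1)) ∧
    (∀ ε : ℝ, 0 < ε → ∀ β : ℝ,
      β ≤ η / 2 * ((1 + ε / 2) ^ (1 / (2 * (Fintype.card S : ℝ))) - 1) →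
      ∀ G₂ : ConcurrentGame S A, G₁.StructEquiv G₂ → G₁.distA G₂ ≤ β →
      ∀ (p : S → ℕ) (π₁ : Strategy S A), π₁.IsPure → π₁.IsMemoryless →
        G₁.IsOptimal (ConcurrentGame.parityObj p) π₁ →
        G₂.IsEpsOptimal (ConcurrentGame.parityObj p) ε π₁) := by
  obtain ⟨_, _, _, _, _, _, _, hη0⟩ := hη.1
  have hclose : ∀ {G₂ : ConcurrentGame S A}, G₁.StructEquiv G₂ → ∀ (p : S → ℕ) (s : S),
      |G₁.val (ConcurrentGame.parityObj p) s - G₂.val (ConcurrentGame.parityObj p) s|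
        ≤ (1 + G₁.distA G₂ / η) ^ (2 * Fintype.card S) - 1 := fun {G₂} h =>
    h.abs_val_sub_le_of_relative hG₁ (div_nonneg (ConcurrentGame.distA_nonneg _ _) hη0.le)
      fun s a ha b hb t => h.abs_prob_sub_le_mul hη ha hb t
  refine ⟨fun G₂ _ h => ⟨fun p s => ⟨?_, hclose h p s⟩, fun η' hη' => ?_⟩, ?_⟩
  · set r := 1 + G₁.distR G₂
    have hr1 : 1 ≤ r := by linarith [h.distR_nonneg]
    have hr0 : 0 < r := by linarith
    refine (h.abs_val_sub_le hG₁ (a := 1 / r) (b := r) (by positivity)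
      (by rw [div_le_one hr0]; exact hr1) hr1 (fun s a ha b hb t => ?_)
      (fun s a ha b hb t => (h.prob_le_distR_mul ha hb t).2) p s).trans ?_
    · rw [one_div_mul_eq_div, div_le_iff₀' hr0]
      exact (h.prob_le_distR_mul ha hb t).1
    · rw [show r / (1 / r) = r ^ 2 by field_simp, ← pow_mul]
      exact sub_le_sub_right (pow_le_pow_right₀ hr1 (by omega)) 1
  · have hr0 := h.distR_nonneg
    have := h.distR_le hη'
    exact sub_le_sub_right (pow_le_pow_left₀ (by linarith) (by linarith) _) 1
  · intro ε hε β hβ G₂ h hd p π₁ hpure hmem hopt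
    obtain ⟨σ, rfl⟩ := Strategy.eq_ofPolicy_of_isPure hpure hmem
    have hσ : ∀ s, σ s ∈ G₁.moves₁ s := fun s =>
      hopt.1 0 (fun _ => s) (by simp [Strategy.ofPolicy, History.last])
    have hx0 : 0 ≤ G₁.distA G₂ / η := div_nonneg (ConcurrentGame.distA_nonneg _ _) hη0.le
    have hbound : (1 + G₁.distA G₂ / η) ^ (2 * Fintype.card S) - 1 ≤ ε / 2 := by
      set y := (1 + ε / 2) ^ (1 / (2 * (Fintype.card S : ℝ))) with hy
      have hy2 : y ^ (2 * Fintype.card S) = 1 + ε / 2 := by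
        have := Real.rpow_inv_natCast_pow (x := 1 + ε / 2) (n := 2 * Fintype.card S)
          (by linarith) (by have := Fintype.card_pos (α := S); omega)
        rw [← this, hy]
        push_cast
        rw [one_div]
      have hle : G₁.distA G₂ / η ≤ (y - 1) / 2 := by
        rw [div_le_iff₀ hη0]
        linarith
      have := pow_le_pow_left₀ (by linarith) (show 1 + G₁.distA G₂ / η ≤ y by linarith)
        (2 * Fintype.card S)
      linarith
    -- binding player 1 to `σ` gives two further player-1 MDPs, to which the first part applies
    have hr : (G₁.restrict σ).StructEquiv (G₂.restrict σ) :=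
      ⟨rfl, h.2.1, fun s a ha b hb => h.2.2 s a
        (by rw [Finset.mem_singleton.1 ha]; exact hσ s) b hb⟩
    have hrclose : ∀ s, |G₁.valOf (ConcurrentGame.parityObj p) (Strategy.ofPolicy σ) s -
        G₂.valOf (ConcurrentGame.parityObj p) (Strategy.ofPolicy σ) s| ≤ ε / 2 := fun s => by
      rw [← ConcurrentGame.val_restrict, ← ConcurrentGame.val_restrict]
      exact (hr.abs_val_sub_le_of_relative hG₁ hx0 (fun s a ha b hb t => h.abs_prob_sub_le_mul hη
        (by rw [Finset.mem_singleton.1 ha]; exact hσ s) hb t) p s).trans hbound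
    refine ⟨ConcurrentGame.ofPolicy_mem_strategies₁ (h.1 ▸ hσ), fun s => ?_⟩
    have h1 := abs_le.1 ((hclose h p s).trans hbound)
    have h2 := abs_le.1 (hrclose s)
    have h3 := hopt.2 s
    linarith
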